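/- **Setting.** Let $X,Z$ be the Pauli matrices, $X'=(X+Z)/\sqrt2$, $Z'=(X-Z)/\sqrt2$, and $\mathcal B=\mathbb C^2$. Let $r\ge 1$. An $r$-qubit stabilizer $S$ is an abelian subgroup, not containing $-I$, of the group of operators $e^{i\phi}P_1\otimes\cdots\otimes P_r$ with $\phi\in\{0,\pi/2,\pi,3\pi/2\}$ and $P_j\in\{I,X,Y,Z\}$; its code space is the simultaneous $+1$-eigenspace of the operators in $S$. Suppose that $S$ is generated by a set of distinct operators $g_1,\dots,g_l$ of $XZ$-form (a sign $\pm1$ times a tensor product of factors $I,X,Z$) and that $S$ is non-trivial: for each $t\in[r]$ one can choose generators $g_X^{(t)}$ and $g_Z^{(t)}$ among $g_1,\dots,g_l$ that have $X$, respectively $Z$, on qubit $t$. Fix such choices. **The stabilizer game.** There are $r$ players. Each of them receives no question (the null question) or a question in $\{0,1,2,3\}$, which she answers by one bit. With probability $1/2$ each, the verifier performs one of the following tests. 1. Choose $j\in[l]$ uniformly. Player $i$ gets the null question, $0$, or $1$ if $g_j$ has $I$, $X$, or $Z$ on qubit $i$. Accept iff the parity of the answers received is $0$ if the sign of $g_j$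 is $+1$, and $1$ if it is $-1$. 2. Choose $t\in[r]$ uniformly, and choose uniformly one of the four operators $h_1=g_X^{(t)}$; $h_2$, which is $g_X^{(t)}$ with the $X$ on qubit $t$ replaced by $Z$; $h_3$, which is $g_Z^{(t)}$ with the $Z$ on qubit $t$ replaced by $X$; and $h_4=-g_Z^{(t)}$. Send questions and decide as in test 1, with the chosen $h_k$ in place of $g_j$, except that player $t$ gets question $2$ for $X$ and $3$ for $Z$. A strategy consists of Hilbert spaces $\mathcal H_1,\dots,\mathcal H_r$, a density operator $\rho$ on $\bigotimes_i\mathcal H_i$, and reflections (self-adjoint operators with square $I$) $R^{(i)}_w$ on $\mathcal H_i$ for $i\in[r]$, $w\in\{0,1,2,3\}$; asked $w$, player $i$ answers $a$ by the projective measurement $\{(I+(-1)^aR^{(i)}_w)/2\}_{a\in\{0,1\}}$. The value of a strategy is its probability of acceptance. Let $\omega^*_{\mathrm S}=(6+\sqrt2)/8$. For operators $A,B$ on $\mathcal H_i$ put $d_\rho(A,B)=\bigl[1-\operatorname{Re}\operatorname{tr}(AB\,\rho)\bigr]^{1/2}$, where $AB$ acts on the factor $\mathcal H_i$. **Theorem.**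 For every $r\ge1$ there is a constant $C>0$, depending only on $r$, such that the following holds for every $S$, $g_1,\dots,g_l$, $g^{(t)}_X$, $g^{(t)}_Z$ as above and every $\varepsilon\ge0$. If a strategy $(\rho,\{R^{(i)}_w\})$ of the stabilizer game has value at least $\omega^*_{\mathrm S}-\varepsilon$, then there are Hilbert spaces $\hat{\mathcal H}_i$ and isometries $V_i:\mathcal H_i\to\mathcal B\otimes\hat{\mathcal H}_i$, $i\in[r]$, such that: - for all $i\in[r]$, $R^{(i)}_3=V_i^\dagger(Z'\otimes I)V_i$ and $$d_\rho\bigl(R^{(i)}_2,V_i^\dagger(X'\otimes I)V_i\bigr)\le C\varepsilon^{1/2},\quad d_\rho\bigl(R^{(i)}_1,V_i^\dagger(Z\otimes I)V_i\bigr)\le C\varepsilon^{1/4},\quad d_\rho\bigl(R^{(i)}_0,V_i^\dagger(X\otimes I)V_i\bigr)\le C\varepsilon^{1/4};$$ - if $\Pi$ is the orthogonal projection onto the code space of $S$ and $V=\bigotimes_iV_i$, then $$\operatorname{tr}\bigl((\Pi\otimes I)\,V\rho V^\dagger\bigr)\ge 1-C\varepsilon^{1/4},$$ where $\Pi$ acts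 on the $r$ qubits, namely the factors $\mathcal B$ of the $r$ spaces $\mathcal B\otimes\hat{\mathcal H}_i$. -/

import Mathlib

open scoped ComplexConjugate ComplexOrder Matrix InnerProductSpace

noncomputable section

namespace StabGame

universe u v

/-! ## Hilbert space tensor products of finitely many Hilbert spaces -/

section Tensor

lemma posSemidef_of_finset {n : Type*} {A : Matrix n n ℂ}
    (h : ∀ s : Finset n, (A.submatrix ((↑) : s → n) (↑)).PosSemidef) : A.PosSemidef := by
  classical
  refine ⟨?_, fun x => ?_⟩
  · ext i j
    have := congrFun (congrFun (h {i, j}).1 ⟨i, by simp⟩) ⟨j, by simp⟩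
    simpa using this
  · have hx := (h x.support).2 (x.subtypeDomain (· ∈ x.support))
    simpa [Finsupp.sum, ← Finset.sum_attach x.support, ← Finset.subtype_mem_eq_attach,
      ← Finsupp.subtypeDomain_apply, ← Finsupp.support_subtypeDomain] using hx

/-- The semi-inner product `⟪∑ₓ aₓ x, ∑ᵧ bᵧ y⟫ = ∑ₓᵧ conj aₓ P(x, y) bᵧ` on the free vector space
over `X` defined by a positive semidefinite kernel `P`. -/
@[reducible] def kernelCore {X : Type*} {P : Matrix X X ℂ} (hP : P.PosSemidef) :
    PreInnerProductSpace.Core ℂ (X →₀ ℂ) where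
  inner f g := f.sum fun x a => g.sum fun y b => star a * P x y * b
  conj_inner_symm f g := by
    rw [Finsupp.sum_comm]
    simp only [map_finsuppSum]
    refine Finsupp.sum_congr fun x _ => Finsupp.sum_congr fun y _ => ?_
    rw [← hP.1.apply y x]
    simp only [RCLike.star_def, map_mul, RingHomCompTriple.comp_apply, RingHom.id_apply]
    ring
  re_inner_nonneg f := (Complex.le_def.1 (hP.2 f)).1
  add_left _ _ _ := by
    rw [Finsupp.sum_add_index'] <;> simp [← Finsupp.sum_add, add_mul]
  smul_left _ _ _ := by
    rw [Finsupp.sum_smul_index] <;> simp [Finsupp.mul_sum, ← mul_assoc]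

lemma posSemidef_gram' {n E : Type*} [NormedAddCommGroup E] [InnerProductSpace ℂ E] (w : n → E) :
    (Matrix.of fun x y => ⟪w x, w y⟫_ℂ : Matrix n n ℂ).PosSemidef :=
  posSemidef_of_finset fun s => Matrix.posSemidef_gram ℂ (fun x : s => w x)

/-- The quadratic form of a kernel on the free vector space. -/
def kernelForm {X : Type*} (P : Matrix X X ℂ) (f : X →₀ ℂ) : ℂ :=
  f.sum fun x a => f.sum fun y b => star a * P x y * b

lemma kernelForm_mapDomain {X Y : Type*} (P : Matrix Y Y ℂ) (φ : X → Y) (f : X →₀ ℂ) :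
    kernelForm P (f.mapDomain φ) = kernelForm (P.submatrix φ φ) f := by
  unfold kernelForm
  rw [Finsupp.sum_mapDomain_index]
  · refine Finsupp.sum_congr fun x _ => ?_
    rw [Finsupp.sum_mapDomain_index]
    · simp
    · simp
    · intros; ring
  · simp
  · intro x a b
    simp [add_mul, ← Finsupp.sum_add]

lemma kernelForm_smul_sub {X : Type*} (P Q : Matrix X X ℂ) (c : ℂ) (f : X →₀ ℂ) :
    kernelForm (c • P - Q) f = c * kernelForm P f - kernelForm Q f := by
  unfold kernelForm
  rw [Finsupp.mul_sum, ← Finsupp.sum_sub]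
  refine Finsupp.sum_congr fun x _ => ?_
  rw [Finsupp.mul_sum, ← Finsupp.sum_sub]
  refine Finsupp.sum_congr fun y _ => ?_
  simp only [Matrix.sub_apply, Matrix.smul_apply, smul_eq_mul]
  ring

variable {ι : Type*}

variable (H : ι → Type u) [∀ i, NormedAddCommGroup (H i)] [∀ i, InnerProductSpace ℂ (H i)]
variable (K : ι → Type v) [∀ i, NormedAddCommGroup (K i)] [∀ i, InnerProductSpace ℂ (K i)]

/-- The kernel `(x, y) ↦ ∏ᵢ ⟪xᵢ, yᵢ⟫`, over a subset `s` of the factors. -/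
def prodGram (s : Finset ι) : Matrix (∀ i, H i) (∀ i, H i) ℂ :=
  Matrix.of fun x y => ∏ i ∈ s, ⟪x i, y i⟫_ℂ

lemma prodGram_posSemidef (s : Finset ι) : (prodGram H s).PosSemidef := by
  classical
  induction s using Finset.induction_on with
  | empty =>
    have h : prodGram H ∅ = Matrix.of fun (x y : ∀ i, H i) => ⟪(1 : ℂ), (1 : ℂ)⟫_ℂ := by
      ext x y; simp [prodGram]
    rw [h]; exact posSemidef_gram' (fun _ => (1 : ℂ))
  | insert a s ha ih =>
    have h : prodGram H (insert a s) =
        (Matrix.of fun (x y : ∀ i, H i) => ⟪x a, y a⟫_ℂ) ⊙ prodGram H s := by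
      ext x y
      simp [prodGram, Finset.prod_insert ha]
    rw [h]; exact (posSemidef_gram' (fun x : (∀ i, H i) => x a)).hadamard ih

variable {H K}

/-- `(xᵢ)ᵢ ↦ (Aᵢ xᵢ)ᵢ`. -/
def mapTuple (A : ∀ i, H i →L[ℂ] K i) (x : ∀ i, H i) (i : ι) : K i := A i (x i)

lemma prodGram_map_le (A : ∀ i, H i →L[ℂ] K i) (s : Finset ι) :
    ((((∏ i ∈ s, ‖A i‖ ^ 2 : ℝ) : ℂ) • prodGram H s) -
      (prodGram K s).submatrix (mapTuple A) (mapTuple A)).PosSemidef := by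
  classical
  induction s using Finset.induction_on with
  | empty =>
    have h : ((((∏ i ∈ (∅ : Finset ι), ‖A i‖ ^ 2 : ℝ) : ℂ) • prodGram H ∅) -
      (prodGram K ∅).submatrix (mapTuple A) (mapTuple A)) = 0 := by
      ext x y; simp [prodGram]
    rw [h]; exact Matrix.PosSemidef.zero
  | insert a s ha ih =>
    have hA : ((‖A a‖ ^ 2) • (Matrix.of fun (x y : ∀ i, H i) => ⟪x a, y a⟫_ℂ) -
        Matrix.of fun (x y : ∀ i, H i) => ⟪A a (x a), A a (y a)⟫_ℂ).PosSemidef :=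
      posSemidef_of_finset fun t => Matrix.posSemidef_opNorm_smul_gram_sub_gram
        (𝕜 := ℂ) (fun x : t => x.1 a) (A a)
    have h1 := ((prodGram_posSemidef K s).submatrix
      (mapTuple A))
    have h2 := (posSemidef_gram' (fun x : (∀ i, H i) => x a)).smul
      (sq_nonneg ‖A a‖)
    have h3 := (h2.hadamard ih).add (hA.hadamard h1)
    convert! h3 using 1
    ext x y
    simp [prodGram, mapTuple, Finset.prod_insert ha]
    ring

variable (H) [Fintype ι]

/-- The free complex vector space on the symbols `⊗ᵢ xᵢ`, with the above inner product. -/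
def PreTensor : Type _ := (∀ i, H i) →₀ ℂ

instance : SeminormedAddCommGroup (PreTensor H) :=
  @InnerProductSpace.Core.toSeminormedAddCommGroup ℂ ((∀ i, H i) →₀ ℂ) _ _ _
    (kernelCore (prodGram_posSemidef H Finset.univ))

instance : InnerProductSpace ℂ (PreTensor H) :=
  InnerProductSpace.ofCore (kernelCore (prodGram_posSemidef H Finset.univ))

/-- The Hilbert space tensor product `⨂ᵢ Hᵢ`: the completion of the span of the symbols
`⊗ᵢ xᵢ` under `⟪⊗ᵢ xᵢ, ⊗ᵢ yᵢ⟫ = ∏ᵢ ⟪xᵢ, yᵢ⟫`, null vectors being identified with `0`. -/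
abbrev HTensor : Type _ := UniformSpace.Completion (PreTensor H)

variable {H}

/-- The linear map `⊗ᵢ xᵢ ↦ ⊗ᵢ Aᵢ xᵢ`. -/
def preTensorMap (A : ∀ i, H i →L[ℂ] K i) : PreTensor H →ₗ[ℂ] PreTensor K where
  toFun f := Finsupp.mapDomain (mapTuple A) f
  map_add' _ _ := Finsupp.mapDomain_add
  map_smul' c f := Finsupp.mapDomain_smul c (f : (∀ i, H i) →₀ ℂ)

lemma preTensor_norm_sq (f : PreTensor H) :
    ((‖f‖ ^ 2 : ℝ) : ℂ) = kernelForm (prodGram H Finset.univ) f := by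
  have h := inner_self_eq_norm_sq_to_K (𝕜 := ℂ) f
  rw [Complex.ofReal_pow]
  exact h.symm

lemma preTensorMap_bound (A : ∀ i, H i →L[ℂ] K i) (f : PreTensor H) :
    ‖preTensorMap A f‖ ≤ (∏ i, ‖A i‖) * ‖f‖ := by
  have e : ((‖preTensorMap A f‖ ^ 2 : ℝ) : ℂ) =
      kernelForm ((prodGram K Finset.univ).submatrix (mapTuple A) (mapTuple A)) f :=
    (preTensor_norm_sq _).trans (kernelForm_mapDomain _ _ _)
  have h0 : 0 ≤ kernelForm _ f := (prodGram_map_le A Finset.univ).2 f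
  have h : 0 ≤ ((∏ i, ‖A i‖ ^ 2 : ℝ) : ℂ) * ((‖f‖ ^ 2 : ℝ) : ℂ) -
      ((‖preTensorMap A f‖ ^ 2 : ℝ) : ℂ) :=
    (h0.trans_eq (kernelForm_smul_sub _ _ _ _)).trans_eq
      (congrArg₂ (fun p q : ℂ => ((∏ i, ‖A i‖ ^ 2 : ℝ) : ℂ) * p - q)
        (preTensor_norm_sq f).symm e.symm)
  have h5 : ‖preTensorMap A f‖ ^ 2 ≤ ((∏ i, ‖A i‖) * ‖f‖) ^ 2 := by
    rw [mul_pow, ← Finset.prod_pow]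
    have := sub_nonneg.1 h
    exact_mod_cast this
  exact le_of_sq_le_sq h5 (by positivity)

/-- The bounded operator `⨂ᵢ Aᵢ : ⨂ᵢ Hᵢ → ⨂ᵢ Kᵢ`. -/
def tensorMap (A : ∀ i, H i →L[ℂ] K i) : HTensor H →L[ℂ] HTensor K :=
  ((preTensorMap A).mkContinuous (∏ i, ‖A i‖) (preTensorMap_bound A)).completion

/-- The operator on `⨂ᵢ Hᵢ` that acts as `A` on the factor `i` and trivially on the others. -/
def onFactor [DecidableEq ι] (i : ι) (A : H i →L[ℂ] H i) : HTensor H →L[ℂ] HTensor H :=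
  tensorMap (Function.update (fun j => ContinuousLinearMap.id ℂ (H j)) i A)

end Tensor

/-! ## Quantum states and distances -/

section States

/-- A fixed orthonormal (Hilbert) basis of a Hilbert space. -/
def stdBasis (E : Type u) [NormedAddCommGroup E] [InnerProductSpace ℂ E] [CompleteSpace E] :
    HilbertBasis (exists_hilbertBasis ℂ E).choose ℂ E :=
  (exists_hilbertBasis ℂ E).choose_spec.choose

variable {E : Type u} [NormedAddCommGroup E] [InnerProductSpace ℂ E] [CompleteSpace E]

/-- The trace `∑ₖ ⟪eₖ, A eₖ⟫`; it is used for trace class operators only, for which the series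
converges absolutely to a value that does not depend on the basis. -/
def trace (A : E →L[ℂ] E) : ℂ := ∑' k, ⟪stdBasis E k, A (stdBasis E k)⟫_ℂ

variable (E) in
/-- Density operators: positive (trace class) operators of trace one. -/
structure DensityOperator where
  op : E →L[ℂ] E
  isPositive : op.IsPositive
  hasTraceOne : HasSum (fun k => ⟪stdBasis E k, op (stdBasis E k)⟫_ℂ) 1

/-- `tr_ρ(M) = tr(M ρ)`. -/
def DensityOperator.tr (ρ : DensityOperator E) (M : E →L[ℂ] E) : ℂ := trace (M ∘L ρ.op)

/-- Reflections: self-adjoint operators with square the identity. -/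
def IsReflection (R : E →L[ℂ] E) : Prop :=
  IsSelfAdjoint R ∧ R ∘L R = ContinuousLinearMap.id ℂ E

/-- The state-dependent distance `d_ρ(A, B) = (1 - Re tr_ρ(A B)) ^ (1/2)` of two operators on the
space of player `i`. -/
def playerDist {r : ℕ} {H : Fin r → Type u} [∀ i, NormedAddCommGroup (H i)]
    [∀ i, InnerProductSpace ℂ (H i)] (ρ : DensityOperator (HTensor H)) (i : Fin r)
    (A B : H i →L[ℂ] H i) : ℝ :=
  Real.sqrt (1 - (ρ.tr (onFactor i (A ∘L B))).re)

end States

/-! ## Pauli operators and stabilizers -/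

section Stabilizers

/-- The one-qubit Pauli matrices. -/
inductive Pauli
  | I | X | Y | Z

/-- The matrix of a one-qubit Pauli operator. -/
def Pauli.mat : Pauli → Matrix (Fin 2) (Fin 2) ℂ
  | .I => 1
  | .X => !![0, 1; 1, 0]
  | .Y => !![0, -Complex.I; Complex.I, 0]
  | .Z => !![1, 0; 0, -1]

/-- `X' = (X + Z) / √2`. -/
def matX' : Matrix (Fin 2) (Fin 2) ℂ := ((1 / Real.sqrt 2 : ℝ) : ℂ) • (Pauli.X.mat + Pauli.Z.mat)

/-- `Z' = (X - Z) / √2`. -/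
def matZ' : Matrix (Fin 2) (Fin 2) ℂ := ((1 / Real.sqrt 2 : ℝ) : ℂ) • (Pauli.X.mat - Pauli.Z.mat)

/-- Matrices acting on `r` qubits, in the computational basis. -/
abbrev QubitMatrix (r : ℕ) := Matrix (Fin r → Fin 2) (Fin r → Fin 2) ℂ

/-- The tensor product `P₁ ⊗ ⋯ ⊗ Pᵣ` of Pauli matrices. -/
def pauliString {r : ℕ} (P : Fin r → Pauli) : QubitMatrix r :=
  Matrix.of fun a b => ∏ i, (P i).mat (a i) (b i)

/-- The `r`-qubit Pauli group, generated by the operators `i ^ k P₁ ⊗ ⋯ ⊗ Pᵣ`. -/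
def pauliGroup (r : ℕ) : Subgroup (QubitMatrix r)ˣ :=
  Subgroup.closure {u | ∃ (k : ℕ) (P : Fin r → Pauli),
    (u : QubitMatrix r) = Complex.I ^ k • pauliString P}

/-- Stabilizers: abelian subgroups of the Pauli group that do not contain `-I`. -/
structure Stabilizer (r : ℕ) where
  group : Subgroup (QubitMatrix r)ˣ
  le_pauliGroup : group ≤ pauliGroup r
  comm : ∀ g ∈ group, ∀ h ∈ group, g * h = h * g
  neg_one_notMem : -1 ∉ group

/-- The code space: the simultaneous `+1`-eigenspace of the operators in the stabilizer. -/
def Stabilizer.codeSpace {r : ℕ} (S : Stabilizer r) :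
    Submodule ℂ (EuclideanSpace ℂ (Fin r → Fin 2)) :=
  ⨅ g ∈ S.group, Module.End.eigenspace (Matrix.toEuclideanLin (g : QubitMatrix r)) 1

/-- The matrix of the orthogonal projection `Π` onto the code space. -/
def Stabilizer.codeProj {r : ℕ} (S : Stabilizer r) : QubitMatrix r :=
  Matrix.toEuclideanLin.symm (S.codeSpace.starProjection : _ →ₗ[ℂ] _)

/-- The tensor factors allowed in operators of `XZ`-form. -/
inductive XZ
  | I | X | Z

def XZ.toPauli : XZ → Pauli
  | .I => .I
  | .X => .X
  | .Z => .Z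

/-- A signed Pauli operator of `XZ`-form, `(-1) ^ sign • word₁ ⊗ ⋯ ⊗ wordᵣ`. -/
structure XZPauli (r : ℕ) where
  sign : ZMod 2
  word : Fin r → XZ

def XZPauli.mat {r : ℕ} (g : XZPauli r) : QubitMatrix r :=
  (-1 : ℂ) ^ g.sign.val • pauliString fun i => (g.word i).toPauli

/-- A non-trivial `r`-qubit stabilizer with a set of `l` generators of `XZ`-form, together with,
for each qubit `t`, a choice of two of these generators, the first having `X` and the second
having `Z` on the qubit `t`. -/
structure XZStabilizer (r l : ℕ) extends Stabilizer r where
  gen : Fin l → XZPauli r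
  gen_injective : Function.Injective gen
  closure_gen : Subgroup.closure {u : (QubitMatrix r)ˣ | ∃ j, (u : QubitMatrix r) = (gen j).mat}
    = group
  selX : Fin r → Fin l
  selZ : Fin r → Fin l
  selX_spec : ∀ t, (gen (selX t)).word t = XZ.X
  selZ_spec : ∀ t, (gen (selZ t)).word t = XZ.Z

end Stabilizers

/-! ## The stabilizer game -/

section Game

/-- What the verifier does in one round: `question i` is the question to player `i`, where `none`
is the null question, and the round is won if the parity of the answers is `parity`. -/
structure Round (r : ℕ) where
  question : Fin r → Option (Fin 4)
  parity : ZMod 2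

/-- The question of a tensor factor on an ordinary player. -/
def XZ.question : XZ → Option (Fin 4)
  | .I => none
  | .X => some 0
  | .Z => some 1

/-- The question of a tensor factor on the special player. -/
def XZ.specialQuestion : XZ → Option (Fin 4)
  | .I => none
  | .X => some 2
  | .Z => some 3

variable {r l : ℕ}

def XZPauli.round (g : XZPauli r) : Round r where
  question i := (g.word i).question
  parity := g.sign

def XZPauli.specialRound (h : XZPauli r) (t : Fin r) : Round r where
  question i := if i = t then (h.word i).specialQuestion else (h.word i).question
  parity := h.sign

/-- The four operators of the special-player game with special player `t`: with `gX`, `gZ` the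
generators chosen for `t`, these are `gX`, `gX` with `X` on qubit `t` replaced by `Z`, `gZ` with `Z`
on qubit `t` replaced by `X`, and `-gZ`. -/
def XZStabilizer.spsOperator (G : XZStabilizer r l) (t : Fin r) : Fin 4 → XZPauli r :=
  let gX := G.gen (G.selX t)
  let gZ := G.gen (G.selZ t)
  ![gX,
    { sign := gX.sign, word := Function.update gX.word t XZ.Z },
    { sign := gZ.sign, word := Function.update gZ.word t XZ.X },
    { sign := gZ.sign + 1, word := gZ.word }]

/-- A strategy of the `r` players on the Hilbert spaces `H i`: a shared state and, for each player
and each question in `{0, 1, 2, 3}`, a reflection. -/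
structure Strategy (H : Fin r → Type u) [∀ i, NormedAddCommGroup (H i)]
    [∀ i, InnerProductSpace ℂ (H i)] [∀ i, CompleteSpace (H i)] where
  ρ : DensityOperator (HTensor H)
  R : ∀ i, Fin 4 → H i →L[ℂ] H i
  isReflection : ∀ i w, IsReflection (R i w)

variable {H : Fin r → Type u} [∀ i, NormedAddCommGroup (H i)]
    [∀ i, InnerProductSpace ℂ (H i)] [∀ i, CompleteSpace (H i)]

/-- The reflection measured on a question, with `R_* = I` for the null question. -/
def Strategy.observable (S : Strategy H) (i : Fin r) : Option (Fin 4) → (H i →L[ℂ] H i)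
  | none => ContinuousLinearMap.id ℂ (H i)
  | some w => S.R i w

/-- The projection `(I + (-1) ^ a R) / 2` for the answer `a`. For the null question this is the
answer `0` with certainty, so that it does not contribute to the parity. -/
def Strategy.meas (S : Strategy H) (i : Fin r) (q : Option (Fin 4)) (a : ZMod 2) :
    H i →L[ℂ] H i :=
  (1 / 2 : ℂ) • (ContinuousLinearMap.id ℂ (H i) + (-1 : ℂ) ^ a.val • S.observable i q)

/-- The probability that the answers have the right parity. -/
def Strategy.acceptProb (S : Strategy H) (q : Round r) : ℝ :=
  ∑ a : Fin r → ZMod 2 with ∑ i, a i = q.parity,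
    (S.ρ.tr (tensorMap fun i => S.meas i (q.question i) (a i))).re

/-- The acceptance probability of a strategy in the first test. -/
def XZStabilizer.testOne (G : XZStabilizer r l) (S : Strategy H) : ℝ :=
  (1 / l) * ∑ j, S.acceptProb (G.gen j).round

/-- The acceptance probability of a strategy in the second test: the special-player stabilizer game
with a uniformly random special player. -/
def XZStabilizer.testTwo (G : XZStabilizer r l) (S : Strategy H) : ℝ :=
  (1 / r) * ∑ t, (1 / 4) * ∑ j, S.acceptProb ((G.spsOperator t j).specialRound t)

/-- The value of a strategy in the stabilizer game. -/
def XZStabilizer.value (G : XZStabilizer r l) (S : Strategy H) : ℝ :=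
  (1 / 2) * G.testOne S + (1 / 2) * G.testTwo S

/-- The constant `ω*_S = (6 + √2) / 8`, the non-local value of the stabilizer game. -/
def omegaS : ℝ := (6 + Real.sqrt 2) / 8

end Game

/-! ## Extracted qubits -/

section Qubits

/-- `ℂ² ⊗ K`, as the Hilbert sum of two copies of `K`. -/
abbrev QubitTensor (K : Type u) : Type u := PiLp 2 fun _ : Fin 2 => K

/-- The operator `M ⊗ I` on `ℂ² ⊗ K`. -/
def qubitOp {K : Type u} [NormedAddCommGroup K] [InnerProductSpace ℂ K]
    (M : Matrix (Fin 2) (Fin 2) ℂ) : QubitTensor K →L[ℂ] QubitTensor K :=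
  (PiLp.continuousLinearEquiv 2 ℂ fun _ : Fin 2 => K).symm.toContinuousLinearMap ∘L
    (ContinuousLinearMap.pi fun a => ∑ b, M a b • ContinuousLinearMap.proj b) ∘L
    (PiLp.continuousLinearEquiv 2 ℂ fun _ : Fin 2 => K).toContinuousLinearMap

/-- The operator `V† (M ⊗ I) V`. -/
def pullback {H K : Type u} [NormedAddCommGroup H] [InnerProductSpace ℂ H] [CompleteSpace H]
    [NormedAddCommGroup K] [InnerProductSpace ℂ K] [CompleteSpace K]
    (V : H →ₗᵢ[ℂ] QubitTensor K) (M : Matrix (Fin 2) (Fin 2) ℂ) : H →L[ℂ] H :=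
  ContinuousLinearMap.adjoint V.toContinuousLinearMap ∘L qubitOp M ∘L V.toContinuousLinearMap

variable {r : ℕ} {H K : Fin r → Type u}
  [∀ i, NormedAddCommGroup (H i)] [∀ i, InnerProductSpace ℂ (H i)] [∀ i, CompleteSpace (H i)]
  [∀ i, NormedAddCommGroup (K i)] [∀ i, InnerProductSpace ℂ (K i)] [∀ i, CompleteSpace (K i)]

/-- The operator `M ⊗ I` on `⨂ᵢ (ℂ² ⊗ Kᵢ)`, where `M` acts on the `r` qubits; here
`M = ∑ M a b • ⨂ᵢ |aᵢ⟩⟨bᵢ|`. -/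
def qubitsOp (K : Fin r → Type u) [∀ i, NormedAddCommGroup (K i)]
    [∀ i, InnerProductSpace ℂ (K i)] (M : QubitMatrix r) :
    HTensor (fun i => QubitTensor (K i)) →L[ℂ] HTensor (fun i => QubitTensor (K i)) :=
  ∑ a, ∑ b, M a b • tensorMap fun i => qubitOp (Matrix.single (a i) (b i) 1)

/-- The isometry `⨂ᵢ Vᵢ`. -/
def tensorIsometry (V : ∀ i, H i →ₗᵢ[ℂ] QubitTensor (K i)) :
    HTensor H →L[ℂ] HTensor (fun i => QubitTensor (K i)) :=
  tensorMap fun i => (V i).toContinuousLinearMap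

/-- The overlap `⟨Π ⊗ I, V ρ V†⟩ = tr((Π ⊗ I) V ρ V†)` with the code space. -/
def codeOverlap (S : Stabilizer r) (ρ : DensityOperator (HTensor H))
    (V : ∀ i, H i →ₗᵢ[ℂ] QubitTensor (K i)) : ℝ :=
  (trace (qubitsOp K S.codeProj ∘L tensorIsometry V ∘L ρ.op ∘L
    ContinuousLinearMap.adjoint (tensorIsometry V))).re

end Qubits

end StabGame

end

open scoped ComplexConjugate ComplexOrder Matrix InnerProductSpace

noncomputable section

namespace StabGame

universe u v w

/-! ## Traces of products of Hilbert–Schmidt operators -/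

section HilbertSchmidt

open ContinuousLinearMap

variable {E : Type u} [NormedAddCommGroup E] [InnerProductSpace ℂ E] [CompleteSpace E]
variable {F : Type v} [NormedAddCommGroup F] [InnerProductSpace ℂ F]
variable {κ ν : Type*}

/-! The argument takes place in the Hilbert space of operators `A ρ^{1/2}` with the Hilbert–Schmidt
inner product, where `⟪A ρ^{1/2}, B ρ^{1/2}⟫ = tr(A† B ρ)`. Estimates are made in the seminorm `‖A
ρ^{1/2}‖`, which left multiplication by a contraction does not increase.

A round accepts with probability `1/2 + 1/2 Re tr(T ρ)`, where `T` is the signed tensor product of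
the reflections measured. For special player `t`, test 2 is therefore a CHSH game between `t`, with
reflections `R₂, R₃`, and the product reflections `A₀, A₁` of all other players. The sum of squares
`chsh_sum_of_squares` bounds its acceptance by `1/2 + √2/4`, and test 1 is bounded by `1`; the two
bounds average to `ω*_S`. A deficit `ε` in the value thus forces every single check to hold up to an
error `δ` of order `√ε` (`Strategy.IsNearOptimal`): each generator round satisfies `T ≈ 1`, and `A₀
≈ (R₂ + R₃)/√2`, `A₁ ≈ (R₂ - R₃)/√2`. The number of generators is bounded in terms of `r`, so the
constants depend on `r` only.

As `A₀² = 1` and `A₀` commutes with `R₂, R₃`, the second relation makes `R₂` and `R₃` anticommute up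
to `O(δ)` (`norm_vec_anticomm_le`). A qubit is extracted explicitly, without Jordan's lemma: for any
two reflections `U, W` there is an isometry pulling `Z'` back to `W` exactly and `X'` back to the
part of `U` odd under conjugation by `W` (`exists_extraction`). Near anticommutation says that this
odd part is close to `U = R₂`. Since `X = (X' + Z')/√2`, the chain `R₀ ≈ A₀ ≈ (R₂ + R₃)/√2 ≈ V†XV`
follows, and likewise for `R₁` and `Z`.

Replacing the factors of a generator one player at a time, `VρV†` is nearly fixed by every
generator, hence by every projection `(1 + g)/2`, hence by their product `Q`. The range of `Q` lies
in the code space, so the overlap is large. -/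

lemma hasSum_norm_sq_inner (f : HilbertBasis ν ℂ F) (x : F) :
    HasSum (fun j => ‖⟪f j, x⟫_ℂ‖ ^ 2) (‖x‖ ^ 2) := by
  have h := f.hasSum_inner_mul_inner x x
  have h2 := Complex.hasSum_re h
  rw [← RCLike.re_eq_complex_re, inner_self_eq_norm_sq] at h2
  convert h2 using 2 with j
  rw [← inner_conj_symm x, Complex.conj_mul', ← Complex.ofReal_pow, RCLike.re_eq_complex_re,
    Complex.ofReal_re]

lemma summable_norm_sq_inner (f : HilbertBasis ν ℂ F) {x : κ → F}
    (hx : Summable fun k => ‖x k‖ ^ 2) :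
    Summable fun p : κ × ν => ‖⟪f p.2, x p.1⟫_ℂ‖ ^ 2 := by
  rw [summable_prod_of_nonneg (fun _ => by positivity)]
  refine ⟨fun k => (hasSum_norm_sq_inner f (x k)).summable, ?_⟩
  simpa only [(hasSum_norm_sq_inner f _).tsum_eq] using hx

variable [CompleteSpace F]

/-- Cyclicity of the trace for a product of two Hilbert–Schmidt operators. -/
lemma tsum_inner_comp_comm (e : HilbertBasis κ ℂ E) (f : HilbertBasis ν ℂ F)
    (A : F →L[ℂ] E) (B : E →L[ℂ] F) (hA : Summable fun k => ‖adjoint A (e k)‖ ^ 2)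
    (hB : Summable fun k => ‖B (e k)‖ ^ 2) :
    ∑' k, ⟪e k, A (B (e k))⟫_ℂ = ∑' j, ⟪f j, B (A (f j))⟫_ℂ := by
  have hs : Summable fun p : κ × ν =>
      ⟪adjoint A (e p.1), f p.2⟫_ℂ * ⟪f p.2, B (e p.1)⟫_ℂ := by
    -- By `xy ≤ x² + y²` the double series is dominated by two Hilbert–Schmidt sums, which permits
    -- exchanging the summations.
    refine Summable.of_norm_bounded
      (((summable_norm_sq_inner f hA).add (summable_norm_sq_inner f hB))) fun p => ?_
    rw [norm_mul, norm_inner_symm]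
    nlinarith [sq_nonneg (‖⟪f p.2, adjoint A (e p.1)⟫_ℂ‖ - ‖⟪f p.2, B (e p.1)⟫_ℂ‖),
      sq_nonneg (‖⟪f p.2, adjoint A (e p.1)⟫_ℂ‖ + ‖⟪f p.2, B (e p.1)⟫_ℂ‖)]
  have h1 : ∀ k, ⟪e k, A (B (e k))⟫_ℂ =
      ∑' j, ⟪adjoint A (e k), f j⟫_ℂ * ⟪f j, B (e k)⟫_ℂ := fun k => by
    rw [f.tsum_inner_mul_inner, adjoint_inner_left]
  have h2 : ∀ j, ⟪f j, B (A (f j))⟫_ℂ =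
      ∑' k, ⟪adjoint A (e k), f j⟫_ℂ * ⟪f j, B (e k)⟫_ℂ := fun j => by
    rw [← adjoint_inner_left, ← e.tsum_inner_mul_inner]
    refine tsum_congr fun k => ?_
    rw [adjoint_inner_left, adjoint_inner_left, mul_comm]
  simp_rw [h1, h2]
  exact Summable.tsum_comm ((Equiv.prodComm ν κ).summable_iff.2 hs)

end HilbertSchmidt

/-! ## The vector representation of a state -/

section GNS

open ContinuousLinearMap

variable {E : Type u} [NormedAddCommGroup E] [InnerProductSpace ℂ E] [CompleteSpace E]
variable {F : Type v} [NormedAddCommGroup F] [InnerProductSpace ℂ F]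
variable {G : Type w} [NormedAddCommGroup G] [InnerProductSpace ℂ G]

/-- The positive square root of a density operator. -/
def DensityOperator.sqrt (ρ : DensityOperator E) : E →L[ℂ] E := CFC.sqrt ρ.op

lemma DensityOperator.sqrt_comp_sqrt (ρ : DensityOperator E) : ρ.sqrt ∘L ρ.sqrt = ρ.op :=
  CFC.sqrt_mul_sqrt_self ρ.op ((nonneg_iff_isPositive _).2 ρ.isPositive)

lemma DensityOperator.adjoint_sqrt (ρ : DensityOperator E) : adjoint ρ.sqrt = ρ.sqrt :=
  (CFC.sqrt_nonneg ρ.op).isSelfAdjoint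

lemma DensityOperator.hasSum_norm_sq_sqrt (ρ : DensityOperator E) :
    HasSum (fun k => ‖ρ.sqrt (stdBasis E k)‖ ^ 2) 1 := by
  have h := Complex.hasSum_re ρ.hasTraceOne
  rw [Complex.one_re] at h
  convert h using 2 with k
  rw [← ρ.sqrt_comp_sqrt, comp_apply, ← adjoint_inner_left, ρ.adjoint_sqrt,
    ← RCLike.re_eq_complex_re, inner_self_eq_norm_sq]

lemma DensityOperator.summable_norm_sq (ρ : DensityOperator E) (A : E →L[ℂ] F) :
    Summable (fun k => ‖A (ρ.sqrt (stdBasis E k))‖ ^ 2) := by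
  refine Summable.of_nonneg_of_le (fun _ => by positivity) (fun k => ?_)
    (ρ.hasSum_norm_sq_sqrt.summable.mul_left (‖A‖ ^ 2))
  rw [← mul_pow]
  gcongr
  exact A.le_opNorm _

/-- The vectors `A ρ^{1/2}` in the space of Hilbert–Schmidt operators, as square-summable
families. -/
def DensityOperator.vec (ρ : DensityOperator E) :
    (E →L[ℂ] F) →ₗ[ℂ] lp (fun _ : (exists_hilbertBasis ℂ E).choose => F) 2 where
  toFun A := ⟨fun k => A (ρ.sqrt (stdBasis E k)), memℓp_gen (by simpa using ρ.summable_norm_sq A)⟩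
  map_add' A B := by ext k; rfl
  map_smul' c A := by ext k; rfl

lemma DensityOperator.inner_vec_eq_tsum (ρ : DensityOperator E) (A B : E →L[ℂ] F) :
    ⟪ρ.vec A, ρ.vec B⟫_ℂ =
      ∑' k, ⟪A (ρ.sqrt (stdBasis E k)), B (ρ.sqrt (stdBasis E k))⟫_ℂ :=
  lp.inner_eq_tsum _ _

lemma DensityOperator.norm_sq_vec (ρ : DensityOperator E) (A : E →L[ℂ] F) :
    HasSum (fun k => ‖A (ρ.sqrt (stdBasis E k))‖ ^ 2) (‖ρ.vec A‖ ^ 2) := by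
  have h := lp.hasSum_norm (p := 2) (by norm_num) (ρ.vec A)
  simp only [ENNReal.toReal_ofNat, Real.rpow_ofNat] at h
  exact h

lemma DensityOperator.norm_vec_isometry (ρ : DensityOperator E) (V : E →L[ℂ] F)
    (hV : ∀ x, ‖V x‖ = ‖x‖) : ‖ρ.vec V‖ = 1 := by
  have h := ρ.norm_sq_vec V
  simp only [hV] at h
  have h1 := h.unique ρ.hasSum_norm_sq_sqrt
  exact (pow_eq_one_iff_of_nonneg (norm_nonneg _) two_ne_zero).1 h1

/-- Only left factors can be discarded at the cost of their operator norm. Later identities are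
therefore arranged so that the small operator stands on the right, next to `ρ^{1/2}`. -/
lemma DensityOperator.norm_vec_comp_le (ρ : DensityOperator E) (A : F →L[ℂ] G) (B : E →L[ℂ] F) :
    ‖ρ.vec (A ∘L B)‖ ≤ ‖A‖ * ‖ρ.vec B‖ := by
  refine le_of_sq_le_sq ?_ (by positivity)
  rw [mul_pow]
  refine hasSum_le (fun k => ?_) (ρ.norm_sq_vec (A ∘L B)) ((ρ.norm_sq_vec B).mul_left _)
  rw [← mul_pow]
  gcongr
  exact A.le_opNorm _

/-- The trace over `F` is split as `(M V ρ^{1/2}) (ρ^{1/2} V†)`, a product of two Hilbert–Schmidt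
operators, and cycled to a trace over `E`. With `V = id` this is the formula for `tr(M ρ)`, with `V`
the tensor isometry the formula for the code overlap. -/
lemma DensityOperator.trace_conj (ρ : DensityOperator E) {F : Type v} [NormedAddCommGroup F]
    [InnerProductSpace ℂ F] [CompleteSpace F] (V : E →L[ℂ] F) (M : F →L[ℂ] F) :
    trace (M ∘L V ∘L ρ.op ∘L adjoint V) = ⟪ρ.vec V, ρ.vec (M ∘L V)⟫_ℂ := by
  have h := tsum_inner_comp_comm (stdBasis E) (stdBasis F) (ρ.sqrt ∘L adjoint V)
    (M ∘L V ∘L ρ.sqrt)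
    (by simpa [adjoint_comp, ρ.adjoint_sqrt] using ρ.summable_norm_sq V)
    (by simpa using ρ.summable_norm_sq (M ∘L V))
  rw [ρ.inner_vec_eq_tsum, trace, ← ρ.sqrt_comp_sqrt]
  simp only [comp_apply] at h ⊢
  rw [← h]
  refine tsum_congr fun k => ?_
  rw [← adjoint_inner_left, ρ.adjoint_sqrt, adjoint_inner_right]

lemma DensityOperator.tr_eq_inner (ρ : DensityOperator E) (M : E →L[ℂ] E) :
    ρ.tr M = ⟪ρ.vec (ContinuousLinearMap.id ℂ E), ρ.vec M⟫_ℂ := by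
  have h := ρ.trace_conj (ContinuousLinearMap.id ℂ E) M
  have h2 : adjoint (ContinuousLinearMap.id ℂ E) = ContinuousLinearMap.id ℂ E :=
    star_one (E →L[ℂ] E)
  simpa [h2, DensityOperator.tr] using h

lemma DensityOperator.inner_vec (ρ : DensityOperator E) {F : Type v} [NormedAddCommGroup F]
    [InnerProductSpace ℂ F] [CompleteSpace F] (A B : E →L[ℂ] F) :
    ⟪ρ.vec A, ρ.vec B⟫_ℂ = ρ.tr (adjoint A ∘L B) := by
  rw [ρ.tr_eq_inner, ρ.inner_vec_eq_tsum, ρ.inner_vec_eq_tsum]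
  refine tsum_congr fun k => ?_
  simp [adjoint_inner_right]

end GNS

/-! ## The tensor product of operators -/

section TensorMap

open ContinuousLinearMap

variable {ι : Type*} [Fintype ι]
variable {H : ι → Type u} [∀ i, NormedAddCommGroup (H i)] [∀ i, InnerProductSpace ℂ (H i)]
variable {K : ι → Type v} [∀ i, NormedAddCommGroup (K i)] [∀ i, InnerProductSpace ℂ (K i)]
variable {L : ι → Type w} [∀ i, NormedAddCommGroup (L i)] [∀ i, InnerProductSpace ℂ (L i)]

/-- The symbol `⊗ᵢ xᵢ` in the free vector space. -/
def prePure (x : ∀ i, H i) : PreTensor H := Finsupp.single x (1 : ℂ)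

/-- The elementary tensor `⊗ᵢ xᵢ`. -/
def pureTensor (x : ∀ i, H i) : HTensor H := (prePure x : PreTensor H)

lemma inner_prePure (x y : ∀ i, H i) : ⟪prePure x, prePure y⟫_ℂ = ∏ i, ⟪x i, y i⟫_ℂ := by
  change (Finsupp.single x (1 : ℂ)).sum (fun x a => (Finsupp.single y (1 : ℂ)).sum fun y b =>
    star a * prodGram H Finset.univ x y * b) = _
  simp [prodGram]

lemma inner_pureTensor (x y : ∀ i, H i) :
    ⟪pureTensor x, pureTensor y⟫_ℂ = ∏ i, ⟪x i, y i⟫_ℂ := by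
  rw [pureTensor, pureTensor, UniformSpace.Completion.inner_coe, inner_prePure]

lemma preTensorMap_prePure (A : ∀ i, H i →L[ℂ] K i) (x : ∀ i, H i) :
    preTensorMap A (prePure x) = prePure fun i => A i (x i) :=
  Finsupp.mapDomain_single

lemma tensorMap_pureTensor (A : ∀ i, H i →L[ℂ] K i) (x : ∀ i, H i) :
    tensorMap A (pureTensor x) = pureTensor fun i => A i (x i) := by
  rw [tensorMap, pureTensor, ContinuousLinearMap.completion_apply_coe]
  exact congrArg _ (preTensorMap_prePure A x)

lemma span_prePure : Submodule.span ℂ (Set.range (prePure (H := H))) = ⊤ := by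
  refine Submodule.eq_top_iff'.2 fun f => ?_
  induction f using Finsupp.induction_linear with
  | zero => exact Submodule.zero_mem _
  | add f g hf hg => exact Submodule.add_mem _ hf hg
  | single x a =>
    have h : (Finsupp.single x a : (∀ i, H i) →₀ ℂ) = a • Finsupp.single x (1 : ℂ) := by simp
    have h2 := Submodule.smul_mem (Submodule.span ℂ (Set.range (prePure (H := H)))) a
      (Submodule.subset_span ⟨x, rfl⟩)
    exact h ▸ h2

lemma clm_ext_pureTensor {G : Type*} [NormedAddCommGroup G] [NormedSpace ℂ G]
    {S T : HTensor H →L[ℂ] G} (h : ∀ x, S (pureTensor x) = T (pureTensor x)) : S = T := by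
  ext z
  induction z using UniformSpace.Completion.induction_on with
  | hp => exact isClosed_eq S.continuous T.continuous
  | ih f =>
    have hf : f ∈ Submodule.span ℂ (Set.range (prePure (H := H))) := by
      rw [span_prePure]; trivial
    induction hf using Submodule.span_induction with
    | mem f hf => obtain ⟨x, rfl⟩ := hf; exact h x
    | zero => simp [UniformSpace.Completion.coe_zero]
    | add f g _ _ hf hg => rw [UniformSpace.Completion.coe_add, map_add, map_add, hf, hg]
    | smul c f _ hf => rw [UniformSpace.Completion.coe_smul, map_smul, map_smul, hf]

/-- The tensor product is a completed free space modulo null vectors, so multilinear relations hold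
only after pairing. Testing against elementary tensors suffices because their span is dense, and
reduces such relations to products of scalar inner products. -/
lemma eq_of_inner_pureTensor {a b : HTensor H}
    (h : ∀ y, ⟪pureTensor y, a⟫_ℂ = ⟪pureTensor y, b⟫_ℂ) : a = b := by
  have h2 : innerSL ℂ a = innerSL ℂ b := clm_ext_pureTensor fun y => by
    have := congrArg conj (h y)
    simpa using this
  have h3 : (innerSL ℂ (a - b)) (a - b) = 0 := by simp [h2]
  rw [innerSL_apply_apply, inner_self_eq_zero] at h3
  exact sub_eq_zero.1 h3

lemma tensor_ext {S T : HTensor H →L[ℂ] HTensor K} (h : ∀ x y,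
    ⟪pureTensor y, S (pureTensor x)⟫_ℂ = ⟪pureTensor y, T (pureTensor x)⟫_ℂ) : S = T :=
  clm_ext_pureTensor fun x => eq_of_inner_pureTensor fun y => h x y

lemma inner_tensorMap (A : ∀ i, H i →L[ℂ] K i) (x : ∀ i, H i) (y : ∀ i, K i) :
    ⟪pureTensor y, tensorMap A (pureTensor x)⟫_ℂ = ∏ i, ⟪y i, A i (x i)⟫_ℂ := by
  rw [tensorMap_pureTensor, inner_pureTensor]

lemma tensorMap_comp (A : ∀ i, K i →L[ℂ] L i) (B : ∀ i, H i →L[ℂ] K i) :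
    tensorMap A ∘L tensorMap B = tensorMap fun i => A i ∘L B i :=
  clm_ext_pureTensor fun x => by simp [tensorMap_pureTensor]

lemma tensorMap_id : tensorMap (fun i => ContinuousLinearMap.id ℂ (H i)) =
    ContinuousLinearMap.id ℂ (HTensor H) :=
  clm_ext_pureTensor fun x => by simp [tensorMap_pureTensor]

lemma adjoint_tensorMap [∀ i, CompleteSpace (H i)] [∀ i, CompleteSpace (K i)]
    (A : ∀ i, H i →L[ℂ] K i) : adjoint (tensorMap A) = tensorMap fun i => adjoint (A i) :=
  tensor_ext fun x y => by
    rw [adjoint_inner_right, tensorMap_pureTensor, tensorMap_pureTensor, inner_pureTensor,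
      inner_pureTensor]
    simp_rw [adjoint_inner_right]

lemma norm_tensorMap_le (A : ∀ i, H i →L[ℂ] K i) : ‖tensorMap A‖ ≤ ∏ i, ‖A i‖ := by
  refine opNorm_le_bound _ (by positivity) fun z => ?_
  induction z using UniformSpace.Completion.induction_on with
  | hp => exact isClosed_le (by fun_prop) (by fun_prop)
  | ih f =>
    rw [tensorMap, ContinuousLinearMap.completion_apply_coe, UniformSpace.Completion.norm_coe,
      UniformSpace.Completion.norm_coe]
    exact preTensorMap_bound A f

lemma norm_tensorMap_le_one {A : ∀ i, H i →L[ℂ] K i} (hA : ∀ i, ‖A i‖ ≤ 1) :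
    ‖tensorMap A‖ ≤ 1 :=
  (norm_tensorMap_le A).trans (Finset.prod_le_one (fun _ _ => norm_nonneg _) fun i _ => hA i)

/-- `A ↦ ⨂ᵢ Aᵢ` as a multilinear map. -/
def tensorMultilinear (H : ι → Type u) [∀ i, NormedAddCommGroup (H i)]
    [∀ i, InnerProductSpace ℂ (H i)] (K : ι → Type v) [∀ i, NormedAddCommGroup (K i)]
    [∀ i, InnerProductSpace ℂ (K i)] :
    MultilinearMap ℂ (fun i => H i →L[ℂ] K i) (HTensor H →L[ℂ] HTensor K) where
  toFun := tensorMap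
  map_update_add' A i B C := by
    classical
    refine tensor_ext fun x y => ?_
    rw [add_apply, inner_add_right, inner_tensorMap, inner_tensorMap, inner_tensorMap,
      ← Finset.mul_prod_erase _ _ (Finset.mem_univ i),
      ← Finset.mul_prod_erase _ _ (Finset.mem_univ i),
      ← Finset.mul_prod_erase _ _ (Finset.mem_univ i)]
    simp only [Function.update_self, add_apply, inner_add_right, add_mul]
    congr 2 <;> refine Finset.prod_congr rfl fun j hj => ?_ <;>
    simp [Function.update_of_ne (Finset.ne_of_mem_erase hj)]
  map_update_smul' A i c B := by
    classical
    refine tensor_ext fun x y => ?_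
    rw [smul_apply, inner_smul_right, inner_tensorMap, inner_tensorMap,
      ← Finset.mul_prod_erase _ _ (Finset.mem_univ i),
      ← Finset.mul_prod_erase _ _ (Finset.mem_univ i)]
    simp only [Function.update_self, smul_apply, inner_smul_right, mul_assoc]
    congr 2; refine Finset.prod_congr rfl fun j hj => ?_
    simp [Function.update_of_ne (Finset.ne_of_mem_erase hj)]

lemma tensorMap_sum {α : ι → Type*} [DecidableEq ι] [∀ i, Fintype (α i)]
    (A : ∀ i, α i → H i →L[ℂ] K i) :
    tensorMap (fun i => ∑ a, A i a) = ∑ a : ∀ i, α i, tensorMap fun i => A i (a i) :=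
  (tensorMultilinear H K).map_sum A

lemma tensorMap_smul (c : ι → ℂ) (A : ∀ i, H i →L[ℂ] K i) :
    tensorMap (fun i => c i • A i) = (∏ i, c i) • tensorMap A :=
  (tensorMultilinear H K).map_smul_univ c A

lemma tensorMap_update_sub [DecidableEq ι] (A : ∀ i, H i →L[ℂ] K i) (i : ι)
    (B C : H i →L[ℂ] K i) : tensorMap (Function.update A i (B - C)) =
      tensorMap (Function.update A i B) - tensorMap (Function.update A i C) :=
  (tensorMultilinear H K).map_update_sub A i B C

variable [DecidableEq ι]

/-- Operators on different factors commute, so any chosen factor may be moved to the right, next to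
the state. -/
lemma tensorMap_eq_comp_onFactor (A : ∀ i, H i →L[ℂ] H i) (i : ι) : tensorMap A =
    tensorMap (Function.update A i (ContinuousLinearMap.id ℂ (H i))) ∘L onFactor i (A i) := by
  rw [onFactor, tensorMap_comp]
  congr 1
  funext j
  rcases eq_or_ne j i with rfl | h
  · simp
  · simp [h]

lemma onFactor_comm_tensorMap (A : ∀ i, H i →L[ℂ] H i) (i : ι)
    (hA : A i = ContinuousLinearMap.id ℂ (H i)) (B : H i →L[ℂ] H i) :
    Commute (tensorMap A) (onFactor i B) := by
  change tensorMap A ∘L onFactor i B = onFactor i B ∘L tensorMap A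
  rw [onFactor, tensorMap_comp, tensorMap_comp]
  congr 1
  funext j
  rcases eq_or_ne j i with rfl | h
  · simp [hA]
  · simp [h]

/-- `A ↦ A` acting on the factor `i`, as a homomorphism of algebras. -/
def onFactorHom (H : ι → Type u) [∀ i, NormedAddCommGroup (H i)]
    [∀ i, InnerProductSpace ℂ (H i)] (i : ι) :
    (H i →L[ℂ] H i) →ₐ[ℂ] (HTensor H →L[ℂ] HTensor H) :=
  AlgHom.ofLinearMap
    ((tensorMultilinear H H).toLinearMap (fun j => ContinuousLinearMap.id ℂ (H j)) i)
    (by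
      change tensorMap (Function.update (fun j => ContinuousLinearMap.id ℂ (H j)) i
        (ContinuousLinearMap.id ℂ (H i))) = _
      rw [Function.update_eq_self_iff.2 rfl]
      exact tensorMap_id)
    (fun A B => by
      change tensorMap (Function.update (fun j => ContinuousLinearMap.id ℂ (H j)) i (A ∘L B)) =
        tensorMap _ ∘L tensorMap _
      rw [tensorMap_comp]
      congr 1
      funext j
      rcases eq_or_ne j i with rfl | h
      · simp
      · simp [h])

lemma onFactorHom_apply (i : ι) (A : H i →L[ℂ] H i) : onFactorHom H i A = onFactor i A := rfl

/-- Replacing the factors of a tensor product of contractions one by one. -/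
lemma norm_vec_tensorMap_sub_le [∀ i, CompleteSpace (H i)] (ρ : DensityOperator (HTensor H))
    {A B : ∀ i, H i →L[ℂ] H i} (hA : ∀ i, ‖A i‖ ≤ 1) (hB : ∀ i, ‖B i‖ ≤ 1) :
    ‖ρ.vec (tensorMap A - tensorMap B)‖ ≤ ∑ i, ‖ρ.vec (onFactor i (A i - B i))‖ := by
  have key : ∀ s : Finset ι, ‖ρ.vec (tensorMap (s.piecewise A B) - tensorMap B)‖ ≤
      ∑ i ∈ s, ‖ρ.vec (onFactor i (A i - B i))‖ := by
    intro s
    induction s using Finset.induction_on with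
    | empty => simp
    | insert i s hi ih =>
      have h1 : tensorMap ((insert i s).piecewise A B) - tensorMap B =
          tensorMap (Function.update (s.piecewise A B) i (A i - B i)) +
            (tensorMap (s.piecewise A B) - tensorMap B) := by
        rw [tensorMap_update_sub, Finset.piecewise_insert]
        have h2 : Function.update (s.piecewise A B) i (B i) = s.piecewise A B := by
          rw [Function.update_eq_self_iff, Finset.piecewise_eq_of_notMem _ _ _ hi]
        rw [h2]; abel
      -- The difference in slot `i` acts first; the factors in the other slots are contractions and
      -- are dropped.
      have h3 : ‖ρ.vec (tensorMap (Function.update (s.piecewise A B) i (A i - B i)))‖ ≤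
          ‖ρ.vec (onFactor i (A i - B i))‖ := by
        rw [tensorMap_eq_comp_onFactor _ i, Function.update_self, Function.update_idem]
        refine (ρ.norm_vec_comp_le _ _).trans (mul_le_of_le_one_left (norm_nonneg _) ?_)
        refine norm_tensorMap_le_one fun j => ?_
        rcases eq_or_ne j i with rfl | h
        · simpa using norm_id_le
        · simp only [ne_eq, h, not_false_eq_true, Function.update_of_ne]
          by_cases hj : j ∈ s
          · simpa [hj] using hA j
          · simpa [hj] using hB j
      rw [h1, map_add, Finset.sum_insert hi]
      exact (norm_add_le _ _).trans (add_le_add h3 ih)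
  simpa using key Finset.univ

end TensorMap

/-! ## Operators on extracted qubits -/

section QubitOp

open ContinuousLinearMap

lemma norm_apply_of_adjoint_comp_self {E : Type u} {F : Type v} [NormedAddCommGroup E]
    [InnerProductSpace ℂ E] [CompleteSpace E] [NormedAddCommGroup F] [InnerProductSpace ℂ F]
    [CompleteSpace F] {A : E →L[ℂ] F} (hA : adjoint A ∘L A = ContinuousLinearMap.id ℂ E) (x : E) :
    ‖A x‖ = ‖x‖ := by
  rw [apply_norm_eq_sqrt_inner_adjoint_left, hA, id_apply, ← norm_eq_sqrt_re_inner]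

lemma opNorm_le_one_of_adjoint_comp_self {E : Type u} {F : Type v} [NormedAddCommGroup E]
    [InnerProductSpace ℂ E] [CompleteSpace E] [NormedAddCommGroup F] [InnerProductSpace ℂ F]
    [CompleteSpace F] {A : E →L[ℂ] F} (hA : adjoint A ∘L A = ContinuousLinearMap.id ℂ E) :
    ‖A‖ ≤ 1 :=
  opNorm_le_bound _ zero_le_one fun x => by rw [norm_apply_of_adjoint_comp_self hA, one_mul]

variable {K : Type u} [NormedAddCommGroup K] [InnerProductSpace ℂ K]

lemma qubitOp_apply (M : Matrix (Fin 2) (Fin 2) ℂ) (x : QubitTensor K) (a : Fin 2) :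
    qubitOp M x a = ∑ b, M a b • x b := by
  simp [qubitOp]

/-- `M ↦ M ⊗ I` as a homomorphism of algebras. -/
def qubitOpHom (K : Type u) [NormedAddCommGroup K] [InnerProductSpace ℂ K] :
    Matrix (Fin 2) (Fin 2) ℂ →ₐ[ℂ] (QubitTensor K →L[ℂ] QubitTensor K) :=
  AlgHom.ofLinearMap
    { toFun := qubitOp
      map_add' := fun M N => by
        ext x a
        rw [qubitOp_apply, add_apply, PiLp.add_apply, qubitOp_apply, qubitOp_apply]
        simp [add_smul, Finset.sum_add_distrib]
      map_smul' := fun c M => by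
        ext x a
        rw [qubitOp_apply, RingHom.id_apply, smul_apply, PiLp.smul_apply, qubitOp_apply]
        simp [mul_smul] }
    (by
      ext x a
      change qubitOp 1 x a = x a
      rw [qubitOp_apply]
      simp [Matrix.one_apply])
    (fun M N => by
      ext x a
      change qubitOp (M * N) x a = qubitOp M (qubitOp N x) a
      simp only [qubitOp_apply, Matrix.mul_apply, Finset.sum_smul, Finset.smul_sum, mul_smul]
      exact Finset.sum_comm)

lemma qubitOpHom_apply (M : Matrix (Fin 2) (Fin 2) ℂ) : qubitOpHom K M = qubitOp M := rfl

lemma qubitOp_mul (M N : Matrix (Fin 2) (Fin 2) ℂ) :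
    (qubitOp (M * N) : QubitTensor K →L[ℂ] QubitTensor K) = qubitOp M ∘L qubitOp N :=
  map_mul (qubitOpHom K) M N

lemma qubitOp_one :
    (qubitOp 1 : QubitTensor K →L[ℂ] QubitTensor K) = ContinuousLinearMap.id ℂ _ :=
  map_one (qubitOpHom K)

lemma qubitOp_eq_sum (M : Matrix (Fin 2) (Fin 2) ℂ) :
    (qubitOp M : QubitTensor K →L[ℂ] QubitTensor K) =
      ∑ p : Fin 2 × Fin 2, M p.1 p.2 • qubitOp (Matrix.single p.1 p.2 1) := by
  simp_rw [← qubitOpHom_apply, ← map_smul, ← map_sum, Fintype.sum_prod_type]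
  congr 1
  conv_lhs => rw [Matrix.matrix_eq_sum_single M]
  simp

lemma adjoint_qubitOp [CompleteSpace K] (M : Matrix (Fin 2) (Fin 2) ℂ) :
    adjoint (qubitOp M : QubitTensor K →L[ℂ] QubitTensor K) = qubitOp Mᴴ := by
  symm
  rw [eq_adjoint_iff]
  intro x y
  simp only [PiLp.inner_apply, qubitOp_apply, sum_inner, inner_sum, inner_smul_left,
    inner_smul_right, Matrix.conjTranspose_apply, RCLike.star_def, RingHomCompTriple.comp_apply,
    RingHom.id_apply]
  exact Finset.sum_comm

lemma opNorm_qubitOp_le [CompleteSpace K] {M : Matrix (Fin 2) (Fin 2) ℂ} (hM : Mᴴ * M = 1) :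
    ‖(qubitOp M : QubitTensor K →L[ℂ] QubitTensor K)‖ ≤ 1 :=
  opNorm_le_one_of_adjoint_comp_self (by rw [adjoint_qubitOp, ← qubitOp_mul, hM, qubitOp_one])

end QubitOp

/-! ### Operators on all `r` extracted qubits together -/

section QubitsOp

open ContinuousLinearMap

variable {r : ℕ}

/-- The Kronecker product of one-qubit matrices. -/
def tensorMatrix (M : Fin r → Matrix (Fin 2) (Fin 2) ℂ) : QubitMatrix r :=
  Matrix.of fun a b => ∏ i, M i (a i) (b i)

lemma tensorMatrix_mul (M N : Fin r → Matrix (Fin 2) (Fin 2) ℂ) :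
    tensorMatrix M * tensorMatrix N = tensorMatrix fun i => M i * N i := by
  ext a b
  simp only [tensorMatrix, Matrix.mul_apply, Matrix.of_apply, Finset.prod_univ_sum,
    Fintype.piFinset_univ, Finset.prod_mul_distrib]

lemma tensorMatrix_one : tensorMatrix (fun _ : Fin r => 1) = 1 := by
  ext a b
  simp only [tensorMatrix, Matrix.of_apply, Matrix.one_apply, Finset.prod_ite_zero,
    Finset.prod_const_one, Finset.mem_univ, true_implies, funext_iff]

lemma conjTranspose_tensorMatrix (M : Fin r → Matrix (Fin 2) (Fin 2) ℂ) :
    (tensorMatrix M)ᴴ = tensorMatrix fun i => (M i)ᴴ := by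
  ext a b
  simp [tensorMatrix]

variable (K : Fin r → Type u) [∀ i, NormedAddCommGroup (K i)] [∀ i, InnerProductSpace ℂ (K i)]

/-- Each factor is expanded in matrix units and the tensor product is multiplied out. -/
lemma qubitsOp_tensorMatrix (M : Fin r → Matrix (Fin 2) (Fin 2) ℂ) :
    qubitsOp K (tensorMatrix M) = tensorMap fun i => qubitOp (M i) := by
  conv_rhs => enter [1, i]; rw [qubitOp_eq_sum]
  rw [tensorMap_sum, qubitsOp, ← Fintype.sum_prod_type']
  refine (Fintype.sum_equiv (Equiv.arrowProdEquivProdArrow _ _ _) _ _ fun p => ?_).symm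
  rw [tensorMap_smul]
  rfl

lemma tensorMap_single_comp (a b c d : Fin r → Fin 2) :
    (tensorMap fun i => (qubitOp (Matrix.single (a i) (b i) 1) :
      QubitTensor (K i) →L[ℂ] QubitTensor (K i))) ∘L
      (tensorMap fun i => qubitOp (Matrix.single (c i) (d i) 1)) =
    if b = c then tensorMap fun i => qubitOp (Matrix.single (a i) (d i) 1) else 0 := by
  rw [tensorMap_comp]
  simp_rw [← qubitOp_mul]
  split_ifs with h
  · subst h; simp
  · obtain ⟨i, hi⟩ := Function.ne_iff.1 h
    refine (tensorMultilinear (fun i => QubitTensor (K i))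
      (fun i => QubitTensor (K i))).map_coord_zero i ?_
    rw [Matrix.single_mul_single_of_ne (h := hi)]
    exact map_zero (qubitOpHom (K i))

/-- `M ↦ M ⊗ I` as a homomorphism of algebras. -/
def qubitsOpHom :
    QubitMatrix r →ₐ[ℂ] (HTensor (fun i => QubitTensor (K i)) →L[ℂ]
      HTensor (fun i => QubitTensor (K i))) :=
  AlgHom.ofLinearMap
    { toFun := qubitsOp K
      map_add' := fun M N => by
        simp [qubitsOp, add_smul, Finset.sum_add_distrib]
      map_smul' := fun c M => by
        simp [qubitsOp, mul_smul, Finset.smul_sum] }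
    (by
      change qubitsOp K 1 = ContinuousLinearMap.id ℂ _
      rw [← tensorMatrix_one, qubitsOp_tensorMatrix]
      simp_rw [qubitOp_one]
      exact tensorMap_id)
    (fun M N => by
      change qubitsOp K (M * N) = qubitsOp K M * qubitsOp K N
      have h : ∀ a b c d : Fin r → Fin 2,
        (tensorMap fun i => (qubitOp (Matrix.single (a i) (b i) 1) :
          QubitTensor (K i) →L[ℂ] QubitTensor (K i))) *
          (tensorMap fun i => qubitOp (Matrix.single (c i) (d i) 1)) =
        if b = c then tensorMap fun i => qubitOp (Matrix.single (a i) (d i) 1) else 0 :=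
        tensorMap_single_comp K
      simp only [qubitsOp, Finset.sum_mul, Finset.mul_sum, smul_mul_assoc, mul_smul_comm, h,
        smul_ite, smul_zero, Matrix.mul_apply, Finset.sum_smul]
      conv_lhs => rw [Finset.sum_comm]
      conv_rhs => rw [Finset.sum_comm]
      refine Finset.sum_congr rfl fun d _ => ?_
      conv_lhs => rw [Finset.sum_comm]
      simp only [Finset.sum_ite_eq', Finset.mem_univ, if_true, Finset.smul_sum, smul_smul,
        mul_comm])

lemma qubitsOpHom_apply (M : QubitMatrix r) : qubitsOpHom K M = qubitsOp K M := rfl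

lemma adjoint_qubitsOp [∀ i, CompleteSpace (K i)] (M : QubitMatrix r) :
    adjoint (qubitsOp K M) = qubitsOp K Mᴴ := by
  simp only [qubitsOp, map_sum, map_smulₛₗ, adjoint_tensorMap, adjoint_qubitOp,
    Matrix.conjTranspose_single, star_one, Matrix.conjTranspose_apply]
  exact Finset.sum_comm

end QubitsOp

/-! ## Extraction of a qubit from two reflections -/

section Extraction

open ContinuousLinearMap

variable {H : Type u} [NormedAddCommGroup H] [InnerProductSpace ℂ H] [CompleteSpace H]
variable {K : Type u} [NormedAddCommGroup K] [InnerProductSpace ℂ K] [CompleteSpace K]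

/-- The isometry `x ↦ ∑ₐ |a⟩ ⊗ Vₐ x`. -/
def columnIsometry (V : Fin 2 → H →L[ℂ] K)
    (hV : ∑ a, adjoint (V a) ∘L V a = ContinuousLinearMap.id ℂ H) : H →ₗᵢ[ℂ] QubitTensor K where
  toFun x := WithLp.toLp 2 fun a => V a x
  map_add' x y := by ext a; simp
  map_smul' c x := by ext a; simp
  norm_map' x := by
    have h : ⟪x, x⟫_ℂ = ∑ a, ⟪V a x, V a x⟫_ℂ := by
      have := congrArg (fun T : H →L[ℂ] H => ⟪x, T x⟫_ℂ) hV
      simpa [inner_add_right, adjoint_inner_right, Fin.sum_univ_two] using this.symm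
    refine (sq_eq_sq₀ (norm_nonneg _) (norm_nonneg _)).1 ?_
    rw [← inner_self_eq_norm_sq (𝕜 := ℂ), ← inner_self_eq_norm_sq (𝕜 := ℂ), h, PiLp.inner_apply]
    rfl

lemma pullback_columnIsometry (V : Fin 2 → H →L[ℂ] K)
    (hV : ∑ a, adjoint (V a) ∘L V a = ContinuousLinearMap.id ℂ H)
    (M : Matrix (Fin 2) (Fin 2) ℂ) :
    pullback (columnIsometry V hV) M = ∑ a, ∑ b, M a b • (adjoint (V a) ∘L V b) := by
  ext x
  refine ext_inner_left ℂ fun y => ?_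
  rw [pullback, comp_apply, adjoint_inner_right, comp_apply, PiLp.inner_apply]
  simp only [qubitOp_apply, sum_apply, inner_sum, smul_apply, comp_apply, inner_smul_right,
    adjoint_inner_right]
  rfl

/-- `M ↦ V† (M ⊗ I) V` as a linear map. -/
def pullbackLin (V : H →ₗᵢ[ℂ] QubitTensor K) :
    Matrix (Fin 2) (Fin 2) ℂ →ₗ[ℂ] (H →L[ℂ] H) where
  toFun := pullback V
  map_add' M N := by
    simp only [pullback, ← qubitOpHom_apply, map_add, add_comp, comp_add]
  map_smul' c M := by
    simp only [pullback, ← qubitOpHom_apply, map_smul, smul_comp, comp_smul, RingHom.id_apply]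

lemma adjoint_comp_isometry (V : H →ₗᵢ[ℂ] K) :
    adjoint V.toContinuousLinearMap ∘L V.toContinuousLinearMap = ContinuousLinearMap.id ℂ H := by
  ext x
  refine ext_inner_left ℂ fun y => ?_
  rw [comp_apply, adjoint_inner_right]
  exact V.inner_map_map y x

lemma pullback_one (V : H →ₗᵢ[ℂ] QubitTensor K) :
    pullback V 1 = ContinuousLinearMap.id ℂ H := by
  rw [pullback, qubitOp_one, id_comp, adjoint_comp_isometry]

lemma opNorm_pullback_le (V : H →ₗᵢ[ℂ] QubitTensor K) {M : Matrix (Fin 2) (Fin 2) ℂ}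
    (hM : Mᴴ * M = 1) : ‖pullback V M‖ ≤ 1 := by
  have h1 : ‖V.toContinuousLinearMap‖ ≤ 1 :=
    opNorm_le_one_of_adjoint_comp_self (adjoint_comp_isometry V)
  have h2 : ‖adjoint V.toContinuousLinearMap‖ ≤ 1 := by
    rwa [LinearIsometryEquiv.norm_map]
  calc ‖pullback V M‖ ≤ ‖adjoint V.toContinuousLinearMap‖ *
        (‖(qubitOp M : QubitTensor K →L[ℂ] _)‖ * ‖V.toContinuousLinearMap‖) :=
      (opNorm_comp_le _ _).trans (mul_le_mul_of_nonneg_left (opNorm_comp_le _ _) (norm_nonneg _))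
    _ ≤ 1 * (1 * 1) := by
      gcongr
      exact opNorm_qubitOp_le hM
    _ = 1 := by norm_num

/-- This computes `Vₐ† V_b` for the two components of the extraction isometry below. The `q`-`q`
corner collapses to `q` because `u² = 1`, so only the off-diagonal corners of `u` survive. -/
lemma mul_of_corners {A : Type*} [Ring A] [Algebra ℂ A] {p q u : A} (hp : p * p = p)
    (hq : q * q = q) (hu : u * u = 1) (a b a' b' : ℂ) :
    (a • p + b • (q * u)) * (a' • p + b' • (u * q)) =
      (a * a') • p + (a * b') • (p * u * q) + (b * a') • (q * u * p) + (b * b') • q := by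
  have h : q * u * (u * q) = q := by rw [mul_assoc, ← mul_assoc u, hu, one_mul, hq]
  simp only [add_mul, mul_add, smul_mul_smul_comm, hp, h, mul_assoc]
  abel

/-- Two reflections `U`, `W` yield a qubit on which `W` acts as `Z'`, while `X'` acts as the part of
`U` that anticommutes with `W`. -/
lemma exists_extraction {U W : H →L[ℂ] H} (hU : IsReflection U) (hW : IsReflection W) :
    ∃ V : H →ₗᵢ[ℂ] QubitTensor H, pullback V matZ' = W ∧
      pullback V matX' = (1 / 2 : ℂ) • (U - W * U * W) := by
  obtain ⟨hU1, hU2⟩ := hU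
  obtain ⟨hW1, hW2⟩ := hW
  change U * U = 1 at hU2
  change W * W = 1 at hW2
  set p : H →L[ℂ] H := (1 / 2 : ℂ) • (1 + W) with hp
  set q : H →L[ℂ] H := (1 / 2 : ℂ) • (1 - W) with hq
  have hpp : p * p = p := by
    rw [hp, smul_mul_smul_comm]
    simp only [add_mul, mul_add, hW2, one_mul, mul_one]
    module
  have hqq : q * q = q := by
    rw [hq, smul_mul_smul_comm]
    simp only [sub_mul, mul_sub, hW2, one_mul, mul_one]
    module
  have hpq : p + q = 1 := by rw [hp, hq]; module
  have hpq' : p - q = W := by rw [hp, hq]; module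
  have hQ : p * U * q + q * U * p = (1 / 2 : ℂ) • (U - W * U * W) := by
    rw [hp, hq]
    simp only [smul_mul_assoc, mul_smul_comm, add_mul, mul_add, sub_mul, mul_sub,
      one_mul, mul_one]
    module
  have hps : star p = p := by rw [hp]; simp [hW1.star_eq]
  have hqs : star q = q := by rw [hq]; simp [hW1.star_eq]
  clear_value p q
  -- The vectors `(s, c)` and `(c, -s)` are the eigenvectors of `Z'` for `1` and `-1`, and `X'`
  -- swaps them.
  set s : ℂ := ((Real.sin (Real.pi / 8) : ℝ) : ℂ) with hs
  set c : ℂ := ((Real.cos (Real.pi / 8) : ℝ) : ℂ) with hc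
  set k : ℂ := ((1 / Real.sqrt 2 : ℝ) : ℂ) with hk
  have hsc : s * s + c * c = 1 := by
    rw [hs, hc, ← sq, ← sq]; exact_mod_cast Real.sin_sq_add_cos_sq _
  have hpi : (2 : ℝ) * (Real.pi / 8) = Real.pi / 4 := by ring
  have h2sc : k * (2 * s * c) = 1 / 2 := by
    rw [hs, hc, hk]
    have := Real.sin_two_mul (Real.pi / 8)
    rw [hpi, Real.sin_pi_div_four] at this
    norm_cast
    rw [← this]
    push_cast
    field_simp
  have hcs : k * (c * c - s * s) = 1 / 2 := by
    rw [hs, hc, hk]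
    have := Real.cos_two_mul' (Real.pi / 8)
    rw [hpi, Real.cos_pi_div_four, sq, sq] at this
    norm_cast
    rw [← this]
    push_cast
    field_simp
  -- This is `x ↦ (s, c) ⊗ p x + (c, -s) ⊗ U q x`. It is isometric because `U` is unitary and `p + q
  -- = 1`; `Z'` pulls back to `p - q = W`, and `X'` to `p U q + q U p`.
  set V : Fin 2 → H →L[ℂ] H := ![s • p + c • (U * q), c • p + (-s) • (U * q)] with hVdef
  have hadj : ∀ a, adjoint (V a) = (![s, c] a) • p + (![c, -s] a) • (q * U) := by
    intro a
    change star (V a) = _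
    fin_cases a <;> simp [V, hps, hqs, hU1.star_eq, hs, hc]
  have hV' : ∀ a, V a = (![s, c] a) • p + (![c, -s] a) • (U * q) := by
    intro a; fin_cases a <;> simp [V]
  have hprod : ∀ a b, adjoint (V a) ∘L V b = (![s, c] a * ![s, c] b) • p +
      (![s, c] a * ![c, -s] b) • (p * U * q) + (![c, -s] a * ![s, c] b) • (q * U * p) +
      (![c, -s] a * ![c, -s] b) • q := by
    intro a b
    rw [hadj, hV' b]
    exact mul_of_corners hpp hqq hU2 _ _ _ _
  have hV : ∑ a, adjoint (V a) ∘L V a = ContinuousLinearMap.id ℂ H := by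
    simp only [hprod, Fin.sum_univ_two]
    change _ = (1 : H →L[ℂ] H)
    rw [← hpq]
    simp only [Matrix.cons_val_zero, Matrix.cons_val_one]
    linear_combination (norm := module) hsc • p + hsc • q
  refine ⟨columnIsometry V hV, ?_, ?_⟩
  · rw [pullback_columnIsometry]
    simp only [hprod, Fin.sum_univ_two]
    rw [← hpq']
    simp only [Matrix.cons_val_zero, Matrix.cons_val_one, matZ', Pauli.mat, Matrix.smul_apply,
      Matrix.sub_apply, Matrix.of_apply, Matrix.cons_val', smul_eq_mul, ← hk,
      Matrix.cons_val_fin_one]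
    linear_combination (norm := module) (h2sc + hcs) • p - (h2sc + hcs) • q +
      (hcs - h2sc) • (p * U * q) + (hcs - h2sc) • (q * U * p)
  · rw [pullback_columnIsometry]
    simp only [hprod, Fin.sum_univ_two]
    rw [← hQ]
    simp only [Matrix.cons_val_zero, Matrix.cons_val_one, matX', Pauli.mat, Matrix.smul_apply,
      Matrix.add_apply, Matrix.of_apply, Matrix.cons_val', smul_eq_mul, ← hk,
      Matrix.cons_val_fin_one]
    linear_combination (norm := module) (h2sc - hcs) • p - (h2sc - hcs) • q +
      (hcs + h2sc) • (p * U * q) + (hcs + h2sc) • (q * U * p)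

lemma pauliX_eq : Pauli.X.mat = ((1 / Real.sqrt 2 : ℝ) : ℂ) • (matX' + matZ') := by
  have h : ((1 / Real.sqrt 2 : ℝ) : ℂ) * ((1 / Real.sqrt 2 : ℝ) : ℂ) = 1 / 2 := by
    rw [← Complex.ofReal_mul, ← sq, div_pow, Real.sq_sqrt two_pos.le]; simp
  rw [matX', matZ', ← smul_add, smul_smul, h]
  module

lemma pauliZ_eq : Pauli.Z.mat = ((1 / Real.sqrt 2 : ℝ) : ℂ) • (matX' - matZ') := by
  have h : ((1 / Real.sqrt 2 : ℝ) : ℂ) * ((1 / Real.sqrt 2 : ℝ) : ℂ) = 1 / 2 := by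
    rw [← Complex.ofReal_mul, ← sq, div_pow, Real.sq_sqrt two_pos.le]; simp
  rw [matX', matZ', ← smul_sub, smul_smul, h]
  module

end Extraction

/-! ## State-dependent estimates -/

section Estimates

open ContinuousLinearMap

variable {E : Type u} [NormedAddCommGroup E] [InnerProductSpace ℂ E] [CompleteSpace E]

lemma IsReflection.star_eq {a : E →L[ℂ] E} (ha : IsReflection a) : star a = a := ha.1.star_eq

lemma IsReflection.mul_self {a : E →L[ℂ] E} (ha : IsReflection a) : a * a = 1 := ha.2

lemma IsReflection.norm_le {a : E →L[ℂ] E} (ha : IsReflection a) : ‖a‖ ≤ 1 :=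
  opNorm_le_one_of_adjoint_comp_self (by
    change star a * a = 1
    rw [ha.star_eq, ha.mul_self])

variable (ρ : DensityOperator E)

lemma DensityOperator.tr_add (A B : E →L[ℂ] E) : ρ.tr (A + B) = ρ.tr A + ρ.tr B := by
  simp only [ρ.tr_eq_inner, map_add, inner_add_right]

lemma DensityOperator.tr_sub (A B : E →L[ℂ] E) : ρ.tr (A - B) = ρ.tr A - ρ.tr B := by
  simp only [ρ.tr_eq_inner, map_sub, inner_sub_right]

lemma DensityOperator.tr_neg (A : E →L[ℂ] E) : ρ.tr (-A) = -ρ.tr A := by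
  simp only [ρ.tr_eq_inner, map_neg, inner_neg_right]

lemma DensityOperator.tr_smul (c : ℂ) (A : E →L[ℂ] E) : ρ.tr (c • A) = c * ρ.tr A := by
  simp only [ρ.tr_eq_inner, map_smul, inner_smul_right]

lemma DensityOperator.tr_sum {κ : Type*} (s : Finset κ) (A : κ → E →L[ℂ] E) :
    ρ.tr (∑ i ∈ s, A i) = ∑ i ∈ s, ρ.tr (A i) := by
  simp only [ρ.tr_eq_inner, map_sum, inner_sum]

lemma DensityOperator.norm_vec_one : ‖ρ.vec (1 : E →L[ℂ] E)‖ = 1 :=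
  ρ.norm_vec_isometry _ fun _ => rfl

lemma DensityOperator.tr_one : ρ.tr 1 = 1 := by
  have h := ρ.tr_eq_inner 1
  change _ = ⟪ρ.vec 1, ρ.vec 1⟫_ℂ at h
  rw [h, inner_self_eq_norm_sq_to_K, ρ.norm_vec_one]
  simp

lemma DensityOperator.tr_star (A : E →L[ℂ] E) : ρ.tr (star A) = conj (ρ.tr A) := by
  rw [ρ.tr_eq_inner A, inner_conj_symm, ρ.inner_vec]
  rfl

lemma DensityOperator.norm_vec_mul_le (A B : E →L[ℂ] E) :
    ‖ρ.vec (A * B)‖ ≤ ‖A‖ * ‖ρ.vec B‖ := ρ.norm_vec_comp_le A B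

lemma DensityOperator.norm_vec_mul_le' {A : E →L[ℂ] E} (hA : ‖A‖ ≤ 1) (B : E →L[ℂ] E) :
    ‖ρ.vec (A * B)‖ ≤ ‖ρ.vec B‖ :=
  (ρ.norm_vec_mul_le A B).trans (mul_le_of_le_one_left (norm_nonneg _) hA)

lemma DensityOperator.norm_vec_sq (A : E →L[ℂ] E) : ‖ρ.vec A‖ ^ 2 = (ρ.tr (star A * A)).re := by
  rw [← inner_self_eq_norm_sq (𝕜 := ℂ), ρ.inner_vec]
  rfl

/-- Cauchy–Schwarz against the unit vector `ρ^{1/2}`. -/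
lemma DensityOperator.re_tr_mul_le {A : E →L[ℂ] E} (hA : ‖A‖ ≤ 1) (B : E →L[ℂ] E) :
    (ρ.tr (A * B)).re ≤ ‖ρ.vec B‖ := by
  rw [ρ.tr_eq_inner]
  refine (Complex.re_le_norm _).trans ((norm_inner_le_norm _ _).trans ?_)
  rw [ρ.norm_vec_isometry _ fun _ => rfl, one_mul]
  exact ρ.norm_vec_mul_le' hA B

lemma DensityOperator.re_tr_le {A : E →L[ℂ] E} (hA : ‖A‖ ≤ 1) : (ρ.tr A).re ≤ 1 := by
  simpa [ρ.norm_vec_one] using ρ.re_tr_mul_le hA 1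

lemma DensityOperator.one_sub_re_tr_le (A : E →L[ℂ] E) :
    1 - (ρ.tr A).re ≤ ‖ρ.vec (A - 1)‖ := by
  have h := ρ.re_tr_mul_le (A := -1) (by rw [norm_neg]; exact norm_id_le) (A - 1)
  rw [neg_one_mul, ρ.tr_neg, ρ.tr_sub, ρ.tr_one] at h
  simp only [Complex.neg_re, Complex.sub_re, Complex.one_re] at h
  linarith

lemma DensityOperator.norm_vec_sub_one_sq {A : E →L[ℂ] E} (hA : IsReflection A) :
    ‖ρ.vec (A - 1)‖ ^ 2 = 2 - 2 * (ρ.tr A).re := by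
  have h : star (A - 1) * (A - 1) = (2 : ℂ) • 1 - (2 : ℂ) • A := by
    rw [star_sub, star_one, hA.star_eq]
    simp only [sub_mul, mul_sub, hA.mul_self, one_mul, mul_one]
    module
  rw [ρ.norm_vec_sq, h, ρ.tr_sub, ρ.tr_smul, ρ.tr_smul, ρ.tr_one]
  simp

/-! ### The CHSH inequality and its near-optimal strategies -/

section CHSH

variable {A₀ A₁ a b : E →L[ℂ] E}

/-- `1 / √2`. -/
def invSqrtTwo : ℝ := 1 / Real.sqrt 2

lemma invSqrtTwo_mul_self : invSqrtTwo * invSqrtTwo = 1 / 2 := by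
  rw [invSqrtTwo, ← sq, div_pow, Real.sq_sqrt two_pos.le, one_pow]

lemma invSqrtTwo_pos : 0 < invSqrtTwo := by unfold invSqrtTwo; positivity

lemma invSqrtTwo_le : invSqrtTwo ≤ 3 / 4 := by
  nlinarith [invSqrtTwo_mul_self, invSqrtTwo_pos]

lemma two_mul_invSqrtTwo : 2 * invSqrtTwo = Real.sqrt 2 := by
  rw [invSqrtTwo, mul_one_div, Real.div_sqrt]

/-- The sum of squares decomposition of the CHSH operator. -/
lemma chsh_sum_of_squares (hA₀ : IsReflection A₀) (hA₁ : IsReflection A₁) (ha : IsReflection a)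
    (hb : IsReflection b) (h0a : Commute A₀ a) (h0b : Commute A₀ b) (h1a : Commute A₁ a)
    (h1b : Commute A₁ b) :
    ‖ρ.vec (A₀ - (invSqrtTwo : ℂ) • (a + b))‖ ^ 2 +
      ‖ρ.vec (A₁ - (invSqrtTwo : ℂ) • (a - b))‖ ^ 2 =
    4 - Real.sqrt 2 * ((ρ.tr (A₀ * a)).re + (ρ.tr (A₀ * b)).re + (ρ.tr (A₁ * a)).re -
      (ρ.tr (A₁ * b)).re) := by
  have hk : (invSqrtTwo : ℂ) * invSqrtTwo = 1 / 2 := by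
    rw [← Complex.ofReal_mul, invSqrtTwo_mul_self]; simp
  have h2 : 2 * (invSqrtTwo : ℂ) = (Real.sqrt 2 : ℝ) := by
    rw [← two_mul_invSqrtTwo]; simp
  have hks : conj (invSqrtTwo : ℂ) = invSqrtTwo := Complex.conj_ofReal _
  have key : star (A₀ - (invSqrtTwo : ℂ) • (a + b)) * (A₀ - (invSqrtTwo : ℂ) • (a + b)) +
      star (A₁ - (invSqrtTwo : ℂ) • (a - b)) * (A₁ - (invSqrtTwo : ℂ) • (a - b)) =
      (4 : ℂ) • (1 : E →L[ℂ] E) -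
        ((Real.sqrt 2 : ℝ) : ℂ) • (A₀ * a + A₀ * b + A₁ * a - A₁ * b) := by
    simp only [star_sub, star_add, star_smul, hA₀.star_eq, hA₁.star_eq, ha.star_eq, hb.star_eq,
      RCLike.star_def,
      hks, sub_mul, mul_sub, smul_mul_assoc, mul_smul_comm,
      add_mul, mul_add, hA₀.mul_self, hA₁.mul_self, ha.mul_self, hb.mul_self, ← h0a.eq, ← h0b.eq,
      ← h1a.eq, ← h1b.eq]
    linear_combination (norm := module) -h2 • (A₀ * a + A₀ * b + A₁ * a - A₁ * b) +
      (4 : ℂ) • hk • (1 : E →L[ℂ] E)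
  rw [ρ.norm_vec_sq, ρ.norm_vec_sq, ← Complex.add_re, ← ρ.tr_add, key, ρ.tr_sub, ρ.tr_smul,
    ρ.tr_smul, ρ.tr_sub, ρ.tr_add, ρ.tr_add, ρ.tr_one, Complex.sub_re, Complex.re_ofReal_mul]
  simp

/-- With `D = (a + b)/√2` one has `D² = 1 + (ab + ba)/2`. Since `A₀² = 1` and `A₀` commutes with
`D`, the anticommutator is `2(D² - A₀²) = -2(D + A₀)(A₀ - D)`, with the small factor on the right.
-/
lemma norm_vec_anticomm_le (hA₀ : IsReflection A₀) (ha : IsReflection a)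
    (hb : IsReflection b) (h0a : Commute A₀ a) (h0b : Commute A₀ b) :
    ‖ρ.vec (a * b + b * a)‖ ≤ 5 * ‖ρ.vec (A₀ - (invSqrtTwo : ℂ) • (a + b))‖ := by
  have hk : (invSqrtTwo : ℂ) * invSqrtTwo = 1 / 2 := by
    rw [← Complex.ofReal_mul, invSqrtTwo_mul_self]; simp
  set D := (invSqrtTwo : ℂ) • (a + b) with hD
  have hDD : D * D = 1 + (1 / 2 : ℂ) • (a * b + b * a) := by
    rw [hD, smul_mul_smul_comm, hk]
    simp only [add_mul, mul_add, ha.mul_self, hb.mul_self]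
    module
  have hc : A₀ * D = D * A₀ := by
    rw [hD, mul_smul_comm, smul_mul_assoc, mul_add, add_mul, h0a.eq, h0b.eq]
  have h : a * b + b * a = ((-2 : ℂ) • (D + A₀)) * (A₀ - D) := by
    simp only [smul_mul_assoc, add_mul, mul_sub, hDD, hc, hA₀.mul_self]
    module
  -- The constant is `2 (2 · 3/4 + 1)`, with `1/√2 ≤ 3/4`.
  have hn : ‖(-2 : ℂ) • (D + A₀)‖ ≤ 5 := by
    rw [norm_smul, hD]
    have h1 : ‖(invSqrtTwo : ℂ) • (a + b)‖ ≤ 3 / 4 * (1 + 1) := by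
      rw [norm_smul, Complex.norm_real, Real.norm_of_nonneg invSqrtTwo_pos.le]
      exact mul_le_mul invSqrtTwo_le ((norm_add_le _ _).trans (add_le_add ha.norm_le hb.norm_le))
        (norm_nonneg _) (by norm_num)
    have h2 := norm_add_le ((invSqrtTwo : ℂ) • (a + b)) A₀
    have h3 := hA₀.norm_le
    have h4 : ‖(-2 : ℂ)‖ = 2 := by simp
    rw [h4]
    linarith
  rw [h]
  exact (ρ.norm_vec_mul_le _ _).trans (mul_le_mul_of_nonneg_right hn (norm_nonneg _))

/-- The part of `a` that anticommutes with the reflection `b`. -/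
def oddPart (a b : E →L[ℂ] E) : E →L[ℂ] E := (1 / 2 : ℂ) • (a - b * a * b)

/-- Both sides equal `1/2 + 1/2 Re tr(abab ρ)`. The defect is quadratic in the anticommutator, which
is why `R₂` obeys the exponent `1/2`. -/
lemma one_sub_re_tr_oddPart (ha : IsReflection a) (hb : IsReflection b) :
    1 - (ρ.tr (a * oddPart a b)).re = (‖ρ.vec (a * b + b * a)‖ / 2) ^ 2 := by
  have h1 : a * oddPart a b = (1 / 2 : ℂ) • 1 - (1 / 2 : ℂ) • (a * b * a * b) := by
    rw [oddPart, mul_smul_comm, mul_sub, ha.mul_self]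
    simp only [mul_assoc, smul_sub]
  have h2 : star (a * b + b * a) * (a * b + b * a) =
      (2 : ℂ) • 1 + (a * b * a * b + star (a * b * a * b)) := by
    have e1 : b * (a * (a * b)) = 1 := by rw [← mul_assoc a, ha.mul_self, one_mul, hb.mul_self]
    have e2 : a * (b * (b * a)) = 1 := by rw [← mul_assoc b, hb.mul_self, one_mul, ha.mul_self]
    simp only [star_add, star_mul, ha.star_eq, hb.star_eq, add_mul, mul_add, mul_assoc, e1, e2]
    module
  rw [div_pow, ρ.norm_vec_sq, h1, h2, ρ.tr_sub, ρ.tr_add, ρ.tr_add, ρ.tr_star, ρ.tr_smul,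
    ρ.tr_smul, ρ.tr_smul, ρ.tr_one, Complex.sub_re, Complex.add_re, Complex.add_re,
    Complex.conj_re]
  have h3 : ((1 / 2 : ℂ) * ρ.tr (a * b * a * b)).re = 1 / 2 * (ρ.tr (a * b * a * b)).re := by
    have : (1 / 2 : ℂ) = ((1 / 2 : ℝ) : ℂ) := by simp
    rw [this, Complex.re_ofReal_mul]
  rw [h3]
  norm_num
  ring

/-- The even part of `a` is `(a + bab)/2 = b(ab + ba)/2`. -/
lemma norm_vec_sub_oddPart_le (hb : IsReflection b) :
    ‖ρ.vec (a - oddPart a b)‖ ≤ ‖ρ.vec (a * b + b * a)‖ / 2 := by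
  have h : a - oddPart a b = (1 / 2 : ℂ) • (b * (a * b + b * a)) := by
    rw [oddPart, mul_add, ← mul_assoc, ← mul_assoc, hb.mul_self, one_mul]
    module
  rw [h, map_smul, norm_smul]
  have := ρ.norm_vec_mul_le' hb.norm_le (a * b + b * a)
  have h4 : ‖(1 / 2 : ℂ)‖ = 1 / 2 := by simp
  rw [h4]
  linarith

/-- If `A₀` has almost perfect correlation with both `c` and `D`, and `D` is close to `X`, then
`c` is close to `X`. -/
lemma norm_vec_sub_le_of_correlated {c D X : E →L[ℂ] E} (hA₀ : IsReflection A₀)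
    {δ : ℝ} (h1 : ‖ρ.vec (A₀ * c - 1)‖ ≤ δ)
    (h2 : ‖ρ.vec (A₀ - D)‖ ≤ δ) (h3 : ‖ρ.vec (D - X)‖ ≤ 2 * δ) :
    ‖ρ.vec (c - X)‖ ≤ 4 * δ := by
  have e : c - X = A₀ * (A₀ * c - 1) + (A₀ - D) + (D - X) := by
    rw [mul_sub, ← mul_assoc, hA₀.mul_self]
    simp
  rw [e, map_add, map_add]
  have h4 := ρ.norm_vec_mul_le' hA₀.norm_le (A₀ * c - 1)
  have h5 := norm_add₃_le (a := ρ.vec (A₀ * (A₀ * c - 1))) (b := ρ.vec (A₀ - D))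
    (c := ρ.vec (D - X))
  linarith

/-- This bound on the squared distance is only linear in `‖(c - X) ρ^{1/2}‖`; its square root yields
the exponent `1/4` for `R₀` and `R₁`. -/
lemma one_sub_re_tr_mul_le {c X : E →L[ℂ] E} (hc : IsReflection c) :
    1 - (ρ.tr (c * X)).re ≤ ‖ρ.vec (c - X)‖ := by
  have h := ρ.re_tr_mul_le hc.norm_le (c - X)
  rw [mul_sub, hc.mul_self, ρ.tr_sub, ρ.tr_one] at h
  simpa using h

end CHSH

/-- Applying a product of contractions that almost fix a vector. -/
lemma norm_vec_list_prod_sub_le {F : Type v} [NormedAddCommGroup F] [InnerProductSpace ℂ F]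
    [CompleteSpace F] (W : E →L[ℂ] F) {η : ℝ} (L : List (F →L[ℂ] F))
    (hL : ∀ p ∈ L, ‖p‖ ≤ 1 ∧ ‖ρ.vec (p ∘L W - W)‖ ≤ η) :
    ‖ρ.vec (L.prod ∘L W - W)‖ ≤ L.length * η := by
  induction L with
  | nil =>
    have h : (1 : F →L[ℂ] F) ∘L W - W = 0 := by
      change ContinuousLinearMap.id ℂ F ∘L W - W = 0
      simp
    simp [h]
  | cons p L ih =>
    have h := ih fun q hq => hL q (List.mem_cons_of_mem _ hq)
    obtain ⟨h1, h2⟩ := hL p List.mem_cons_self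
    have e : (p :: L).prod ∘L W - W = p ∘L (L.prod ∘L W - W) + (p ∘L W - W) := by
      rw [List.prod_cons, comp_sub]
      change p ∘L L.prod ∘L W - W = _
      abel
    have h3 := (ρ.norm_vec_comp_le p (L.prod ∘L W - W)).trans
      (mul_le_of_le_one_left (norm_nonneg _) h1)
    rw [e, map_add, List.length_cons]
    push_cast
    linarith [norm_add_le (ρ.vec (p ∘L (L.prod ∘L W - W))) (ρ.vec (p ∘L W - W))]

end Estimates

/-! ## The code space -/

section Code

variable {r l : ℕ}

lemma Pauli.mat_mul_self (P : Pauli) : P.mat * P.mat = 1 := by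
  cases P <;> simp [Pauli.mat, Matrix.one_fin_two]

lemma Pauli.conjTranspose_mat (P : Pauli) : P.matᴴ = P.mat := by
  cases P <;> ext i j <;> fin_cases i <;> fin_cases j <;> simp [Pauli.mat]

/-- The sign `(-1) ^ p`. -/
def paritySign (p : ZMod 2) : ℂ := (-1) ^ p.val

lemma paritySign_add (p q : ZMod 2) : paritySign (p + q) = paritySign p * paritySign q := by
  have h : ∀ p q : Fin 2, paritySign (p + q : ZMod 2) = paritySign p * paritySign q := by
    intro p q
    fin_cases p <;> fin_cases q <;> simp [paritySign, ZMod.val]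
  exact h p q

lemma paritySign_zero : paritySign 0 = 1 := by simp [paritySign]

lemma paritySign_one : paritySign 1 = -1 := by
  rw [paritySign, ZMod.val_one, pow_one]

lemma paritySign_mul_self (p : ZMod 2) : paritySign p * paritySign p = 1 := by
  rw [← paritySign_add, CharTwo.add_self_eq_zero, paritySign_zero]

lemma conj_paritySign (p : ZMod 2) : conj (paritySign p) = paritySign p := by
  simp [paritySign]

lemma norm_paritySign (p : ZMod 2) : ‖paritySign p‖ = 1 := by
  simp [paritySign]

lemma XZPauli.mat_eq (g : XZPauli r) :
    g.mat = paritySign g.sign • tensorMatrix fun i => (g.word i).toPauli.mat := rfl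

lemma XZPauli.mat_mul_self (g : XZPauli r) : g.mat * g.mat = 1 := by
  rw [g.mat_eq, smul_mul_smul_comm, paritySign_mul_self, one_smul, tensorMatrix_mul]
  simp_rw [Pauli.mat_mul_self]
  exact tensorMatrix_one

lemma XZPauli.conjTranspose_mat (g : XZPauli r) : g.matᴴ = g.mat := by
  rw [g.mat_eq, Matrix.conjTranspose_smul, conjTranspose_tensorMatrix, RCLike.star_def,
    conj_paritySign]
  simp_rw [Pauli.conjTranspose_mat]

/-- A signed Pauli operator as a unit of the matrix algebra. -/
def XZPauli.unit (g : XZPauli r) : (QubitMatrix r)ˣ where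
  val := g.mat
  inv := g.mat
  val_inv := g.mat_mul_self
  inv_val := g.mat_mul_self

/-- The projection onto the `+1`-eigenspace of a signed Pauli operator. -/
def XZPauli.proj (g : XZPauli r) : QubitMatrix r := (1 / 2 : ℂ) • (1 + g.mat)

lemma XZStabilizer.gen_mem (G : XZStabilizer r l) (j : Fin l) : (G.gen j).unit ∈ G.group := by
  rw [← G.closure_gen]
  exact Subgroup.subset_closure ⟨j, rfl⟩

lemma XZStabilizer.gen_commute (G : XZStabilizer r l) (j k : Fin l) :
    Commute (G.gen j).mat (G.gen k).mat :=
  congrArg Units.val (G.comm _ (G.gen_mem j) _ (G.gen_mem k))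

lemma mul_list_prod_eq {M : Type*} [Monoid M] {g p : M} (hgp : g * p = p) (L : List M)
    (hp : p ∈ L) (hL : ∀ q ∈ L, Commute g q) : g * L.prod = L.prod := by
  induction L with
  | nil => simp at hp
  | cons q L ih =>
    rw [List.prod_cons]
    rcases List.mem_cons.1 hp with rfl | h
    · rw [← mul_assoc, hgp]
    · rw [← mul_assoc, (hL q List.mem_cons_self).eq, mul_assoc,
        ih h fun q hq => hL q (List.mem_cons_of_mem _ hq)]

/-- A generator is absorbed by its own projection `(1 + g)/2` after commuting past the others; this
property passes to products and inverses. -/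
lemma XZStabilizer.mul_prod_proj (G : XZStabilizer r l) {g : (QubitMatrix r)ˣ}
    (hg : g ∈ G.group) : (g : QubitMatrix r) * (List.ofFn fun j => (G.gen j).proj).prod =
      (List.ofFn fun j => (G.gen j).proj).prod := by
  rw [← G.closure_gen] at hg
  induction hg using Subgroup.closure_induction with
  | mem g hg =>
    obtain ⟨j, hj⟩ := hg
    refine mul_list_prod_eq (p := (G.gen j).proj) ?_ _ ?_ ?_
    · rw [hj, XZPauli.proj, mul_smul_comm, mul_add, mul_one, XZPauli.mat_mul_self, add_comm]
    · exact List.mem_ofFn.2 ⟨j, rfl⟩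
    · intro q hq
      obtain ⟨k, rfl⟩ := List.mem_ofFn.1 hq
      rw [hj]
      exact ((Commute.one_right _).add_right (G.gen_commute j k)).smul_right _
  | one => simp
  | mul g h _ _ hg hh => rw [Units.val_mul, mul_assoc, hh, hg]
  | inv g _ hg =>
    conv_lhs => rw [← hg]
    rw [← mul_assoc, Units.inv_mul, one_mul]

lemma Stabilizer.toEuclideanLin_codeProj (S : Stabilizer r) :
    Matrix.toEuclideanLin S.codeProj = (S.codeSpace.starProjection : _ →ₗ[ℂ] _) :=
  LinearEquiv.apply_symm_apply _ _

/-- The hypothesis puts the range of `Q` inside the code space. -/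
lemma Stabilizer.codeProj_mul_eq (S : Stabilizer r) {Q : QubitMatrix r}
    (hQ : ∀ g ∈ S.group, (g : QubitMatrix r) * Q = Q) : S.codeProj * Q = Q := by
  refine Matrix.toEuclideanLin.injective ?_
  rw [Matrix.toLpLin_mul_same, S.toEuclideanLin_codeProj]
  refine LinearMap.ext fun v => ?_
  refine Submodule.starProjection_eq_self_iff.2 ?_
  simp only [Stabilizer.codeSpace, Submodule.mem_iInf, Module.End.mem_eigenspace_iff, one_smul]
  intro g hg
  conv_rhs => rw [← hQ g hg, Matrix.toLpLin_mul_same]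
  rfl

lemma Stabilizer.codeProj_mul_self (S : Stabilizer r) : S.codeProj * S.codeProj = S.codeProj := by
  refine Matrix.toEuclideanLin.injective ?_
  rw [Matrix.toLpLin_mul_same, S.toEuclideanLin_codeProj]
  refine LinearMap.ext fun v => ?_
  exact Submodule.starProjection_eq_self_iff.2 (Submodule.starProjection_apply_mem _ _)

lemma Stabilizer.conjTranspose_codeProj (S : Stabilizer r) : S.codeProjᴴ = S.codeProj := by
  refine Matrix.isSymmetric_toEuclideanLin_iff.1 ?_
  rw [S.toEuclideanLin_codeProj]
  exact Submodule.starProjection_isSymmetric _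

end Code

/-! ## Acceptance probabilities -/

section Acceptance

open ContinuousLinearMap

variable {r l : ℕ} {H : Fin r → Type u} [∀ i, NormedAddCommGroup (H i)]
    [∀ i, InnerProductSpace ℂ (H i)] [∀ i, CompleteSpace (H i)] (S : Strategy H)

lemma isReflection_id {E : Type u} [NormedAddCommGroup E] [InnerProductSpace ℂ E]
    [CompleteSpace E] : IsReflection (ContinuousLinearMap.id ℂ E) :=
  ⟨IsSelfAdjoint.one (E →L[ℂ] E), rfl⟩

lemma isReflection_tensorMap {A : ∀ i, H i →L[ℂ] H i} (hA : ∀ i, IsReflection (A i)) :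
    IsReflection (tensorMap A) := by
  refine ⟨?_, ?_⟩
  · change adjoint (tensorMap A) = tensorMap A
    rw [adjoint_tensorMap]
    exact congrArg _ (funext fun i => (hA i).1)
  · rw [tensorMap_comp, ← tensorMap_id]
    exact congrArg _ (funext fun i => (hA i).2)

lemma isReflection_onFactor (i : Fin r) {A : H i →L[ℂ] H i} (hA : IsReflection A) :
    IsReflection (onFactor i A) := by
  refine isReflection_tensorMap fun j => ?_
  rcases eq_or_ne j i with rfl | h
  · simpa using hA
  · simpa [h] using isReflection_id

lemma IsReflection.paritySign_smul {E : Type u} [NormedAddCommGroup E] [InnerProductSpace ℂ E]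
    [CompleteSpace E] {A : E →L[ℂ] E} (hA : IsReflection A) (p : ZMod 2) :
    IsReflection (paritySign p • A) := by
  refine ⟨?_, ?_⟩
  · rw [isSelfAdjoint_iff, star_smul, hA.star_eq, RCLike.star_def, conj_paritySign]
  · change paritySign p • A * paritySign p • A = 1
    rw [smul_mul_smul_comm, hA.mul_self, paritySign_mul_self, one_smul]

lemma Strategy.isReflection_observable (i : Fin r) (q : Option (Fin 4)) :
    IsReflection (S.observable i q) := by
  cases q with
  | none => exact isReflection_id
  | some w => exact S.isReflection i w

/-- The signed product of the observables measured in a round. -/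
def Strategy.roundOp (q : Round r) : HTensor H →L[ℂ] HTensor H :=
  paritySign q.parity • tensorMap fun i => S.observable i (q.question i)

lemma Strategy.isReflection_roundOp (q : Round r) : IsReflection (S.roundOp q) :=
  (isReflection_tensorMap fun i => S.isReflection_observable i _).paritySign_smul _

lemma paritySign_sum {κ : Type*} (s : Finset κ) (a : κ → ZMod 2) :
    paritySign (∑ i ∈ s, a i) = ∏ i ∈ s, paritySign (a i) := by
  classical
  induction s using Finset.induction_on with
  | empty => simp [paritySign_zero]
  | insert i s hi ih => rw [Finset.sum_insert hi, Finset.prod_insert hi, paritySign_add, ih]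

lemma sum_zmod_two {M : Type*} [AddCommMonoid M] (f : ZMod 2 → M) : ∑ a, f a = f 0 + f 1 :=
  Fin.sum_univ_two f

lemma Strategy.sum_meas (i : Fin r) (q : Option (Fin 4)) :
    ∑ a, S.meas i q a = ContinuousLinearMap.id ℂ (H i) := by
  rw [sum_zmod_two]
  change (1 / 2 : ℂ) • (_ + paritySign 0 • _) + (1 / 2 : ℂ) • (_ + paritySign 1 • _) = _
  rw [paritySign_zero, paritySign_one]
  module

lemma Strategy.sum_paritySign_smul_meas (i : Fin r) (q : Option (Fin 4)) :
    ∑ a, paritySign a • S.meas i q a = S.observable i q := by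
  rw [sum_zmod_two]
  change paritySign 0 • (1 / 2 : ℂ) • (_ + paritySign 0 • _) +
    paritySign 1 • (1 / 2 : ℂ) • (_ + paritySign 1 • _) = _
  rw [paritySign_zero, paritySign_one]
  module

lemma parity_indicator (p q : ZMod 2) :
    (if p = q then (1 : ℂ) else 0) = 1 / 2 * (1 + paritySign q * paritySign p) := by
  by_cases h : p = q
  · rw [if_pos h, h, paritySign_mul_self]; norm_num
  · have h1 : q + p = 1 := by
      revert p q; decide
    rw [if_neg h, ← paritySign_add, h1, paritySign_one]; norm_num

/-- The indicator of the right parity is `(1 + χ(parity) χ(∑ aᵢ))/2` for the sign character `χ`. The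
constant term sums to the identity, and the character term factors over the players into the product
of the observables. -/
lemma Strategy.sum_tensorMap_meas (q : Round r) :
    ∑ a : Fin r → ZMod 2 with ∑ i, a i = q.parity,
      tensorMap (fun i => S.meas i (q.question i) (a i)) = (1 / 2 : ℂ) • (1 + S.roundOp q) := by
  have h1 : (1 : HTensor H →L[ℂ] HTensor H) =
      ∑ a : Fin r → ZMod 2, tensorMap fun i => S.meas i (q.question i) (a i) := by
    rw [← tensorMap_sum]
    simp_rw [S.sum_meas]
    exact tensorMap_id.symm
  have h2 : tensorMap (fun i => S.observable i (q.question i)) =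
      ∑ a : Fin r → ZMod 2, paritySign (∑ i, a i) •
        tensorMap fun i => S.meas i (q.question i) (a i) := by
    simp_rw [← S.sum_paritySign_smul_meas]
    rw [tensorMap_sum]
    refine Finset.sum_congr rfl fun a _ => ?_
    rw [tensorMap_smul, paritySign_sum]
  rw [Strategy.roundOp, h1, h2, Finset.sum_filter, Finset.smul_sum, ← Finset.sum_add_distrib,
    Finset.smul_sum]
  refine Finset.sum_congr rfl fun a _ => ?_
  have h3 := parity_indicator (∑ i, a i) q.parity
  calc _ = (if ∑ i, a i = q.parity then (1 : ℂ) else 0) •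
        tensorMap fun i => S.meas i (q.question i) (a i) := by rw [ite_smul, one_smul, zero_smul]
    _ = _ := by rw [h3]; module

lemma Strategy.acceptProb_eq (q : Round r) :
    S.acceptProb q = 1 / 2 + 1 / 2 * (S.ρ.tr (S.roundOp q)).re := by
  rw [Strategy.acceptProb, ← Complex.re_sum, ← S.ρ.tr_sum, S.sum_tensorMap_meas, S.ρ.tr_smul,
    S.ρ.tr_add, S.ρ.tr_one]
  have : (1 / 2 : ℂ) = ((1 / 2 : ℝ) : ℂ) := by simp
  rw [this, Complex.re_ofReal_mul, Complex.add_re, Complex.one_re]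
  ring

/-- The signed product of the observables of all players but `t`. -/
def Strategy.restOp (g : XZPauli r) (t : Fin r) : HTensor H →L[ℂ] HTensor H :=
  paritySign g.sign • tensorMap (Function.update
    (fun i => S.observable i (g.word i).question) t (ContinuousLinearMap.id ℂ (H t)))

lemma Strategy.isReflection_restOp (g : XZPauli r) (t : Fin r) :
    IsReflection (S.restOp g t) := by
  refine (isReflection_tensorMap fun j => ?_).paritySign_smul _
  rcases eq_or_ne j t with rfl | h
  · simpa using isReflection_id
  · simpa [h] using S.isReflection_observable _ _

lemma Strategy.restOp_commute (g : XZPauli r) (t : Fin r) (B : H t →L[ℂ] H t) :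
    Commute (S.restOp g t) (onFactor t B) :=
  (onFactor_comm_tensorMap _ t (by simp) B).smul_left _

/-- The player `t` is split off. The remaining sign cancels in every round used below except that of
`-g_Z`, where it supplies the minus sign of CHSH. -/
lemma Strategy.roundOp_eq (q : Round r) (g : XZPauli r) (t : Fin r)
    (hq : ∀ i, i ≠ t → q.question i = (g.word i).question) :
    S.roundOp q = (paritySign q.parity * paritySign g.sign) •
      (S.restOp g t * onFactor t (S.observable t (q.question t))) := by
  rw [Strategy.restOp, smul_mul_assoc, smul_smul, mul_assoc, paritySign_mul_self, mul_one,
    Strategy.roundOp, tensorMap_eq_comp_onFactor _ t]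
  congr 3
  funext i
  rcases eq_or_ne i t with rfl | h
  · simp
  · simp [h, hq i h]

variable (G : XZStabilizer r l) (t : Fin r)

lemma Strategy.roundOp_selX : S.roundOp (G.gen (G.selX t)).round =
    S.restOp (G.gen (G.selX t)) t * onFactor t (S.R t 0) := by
  rw [S.roundOp_eq _ (G.gen (G.selX t)) t fun i _ => rfl]
  simp [XZPauli.round, G.selX_spec, XZ.question, Strategy.observable, paritySign_mul_self]

lemma Strategy.roundOp_selZ : S.roundOp (G.gen (G.selZ t)).round =
    S.restOp (G.gen (G.selZ t)) t * onFactor t (S.R t 1) := by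
  rw [S.roundOp_eq _ (G.gen (G.selZ t)) t fun i _ => rfl]
  simp [XZPauli.round, G.selZ_spec, XZ.question, Strategy.observable, paritySign_mul_self]

lemma Strategy.roundOp_special_zero : S.roundOp ((G.spsOperator t 0).specialRound t) =
    S.restOp (G.gen (G.selX t)) t * onFactor t (S.R t 2) := by
  rw [S.roundOp_eq _ (G.gen (G.selX t)) t fun i hi => by
    simp [XZPauli.specialRound, XZStabilizer.spsOperator, hi]]
  simp [XZPauli.specialRound, XZStabilizer.spsOperator, G.selX_spec, XZ.specialQuestion,
    Strategy.observable, paritySign_mul_self]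

lemma Strategy.roundOp_special_one : S.roundOp ((G.spsOperator t 1).specialRound t) =
    S.restOp (G.gen (G.selX t)) t * onFactor t (S.R t 3) := by
  rw [S.roundOp_eq _ (G.gen (G.selX t)) t fun i hi => by
    simp [XZPauli.specialRound, XZStabilizer.spsOperator, hi]]
  simp [XZPauli.specialRound, XZStabilizer.spsOperator, XZ.specialQuestion,
    Strategy.observable, paritySign_mul_self]

lemma Strategy.roundOp_special_two : S.roundOp ((G.spsOperator t 2).specialRound t) =
    S.restOp (G.gen (G.selZ t)) t * onFactor t (S.R t 2) := by
  rw [S.roundOp_eq _ (G.gen (G.selZ t)) t fun i hi => by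
    simp [XZPauli.specialRound, XZStabilizer.spsOperator, hi]]
  simp [XZPauli.specialRound, XZStabilizer.spsOperator, XZ.specialQuestion,
    Strategy.observable, paritySign_mul_self]

lemma Strategy.roundOp_special_three : S.roundOp ((G.spsOperator t 3).specialRound t) =
    -(S.restOp (G.gen (G.selZ t)) t * onFactor t (S.R t 3)) := by
  rw [S.roundOp_eq _ (G.gen (G.selZ t)) t fun i hi => by
    simp [XZPauli.specialRound, XZStabilizer.spsOperator, hi]]
  simp [XZPauli.specialRound, XZStabilizer.spsOperator, G.selZ_spec, XZ.specialQuestion,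
    Strategy.observable, paritySign_add, paritySign_one, paritySign_mul_self]

/-- `‖(A₀ - (R₂ + R₃) / √2) ρ^{1/2}‖² + ‖(A₁ - (R₂ - R₃) / √2) ρ^{1/2}‖²` for the special
player `t`, where `A₀` and `A₁` are the products of the observables of the others. -/
def Strategy.chshDefect : ℝ :=
  ‖S.ρ.vec (S.restOp (G.gen (G.selX t)) t -
    (invSqrtTwo : ℂ) • (onFactor t (S.R t 2) + onFactor t (S.R t 3)))‖ ^ 2 +
  ‖S.ρ.vec (S.restOp (G.gen (G.selZ t)) t -
    (invSqrtTwo : ℂ) • (onFactor t (S.R t 2) - onFactor t (S.R t 3)))‖ ^ 2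

/-- The average equals `1/2` plus an eighth of the CHSH expression, which by the sum of squares is
`(4 - defect)/√2`. -/
lemma Strategy.special_acceptProb :
    (1 / 4) * ∑ j, S.acceptProb ((G.spsOperator t j).specialRound t) =
      1 / 2 + Real.sqrt 2 / 4 - Real.sqrt 2 / 16 * S.chshDefect G t := by
  have h := chsh_sum_of_squares S.ρ (S.isReflection_restOp (G.gen (G.selX t)) t)
    (S.isReflection_restOp (G.gen (G.selZ t)) t)
    (isReflection_onFactor t (S.isReflection t 2)) (isReflection_onFactor t (S.isReflection t 3))
    (S.restOp_commute _ t _) (S.restOp_commute _ t _) (S.restOp_commute _ t _)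
    (S.restOp_commute _ t _)
  rw [Strategy.chshDefect, h]
  simp only [Fin.sum_univ_four, S.acceptProb_eq, S.roundOp_special_zero, S.roundOp_special_one,
    S.roundOp_special_two, S.roundOp_special_three, S.ρ.tr_neg, Complex.neg_re]
  have h2 : Real.sqrt 2 * Real.sqrt 2 = 2 := Real.mul_self_sqrt two_pos.le
  linear_combination (-1 / 16 : ℝ) * ((S.ρ.tr (S.restOp (G.gen (G.selX t)) t *
    onFactor t (S.R t 2))).re + (S.ρ.tr (S.restOp (G.gen (G.selX t)) t *
    onFactor t (S.R t 3))).re + (S.ρ.tr (S.restOp (G.gen (G.selZ t)) t *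
    onFactor t (S.R t 2))).re - (S.ρ.tr (S.restOp (G.gen (G.selZ t)) t *
    onFactor t (S.R t 3))).re) * h2

lemma average_le {n : ℕ} (hn : 0 < n) {x : Fin n → ℝ} {M : ℝ} (hx : ∀ i, x i ≤ M) :
    (1 / n) * ∑ i, x i ≤ M := by
  have h := Finset.sum_le_card_nsmul Finset.univ x M fun i _ => hx i
  rw [Finset.card_univ, Fintype.card_fin, nsmul_eq_mul] at h
  rw [one_div, inv_mul_le_iff₀ (by exact_mod_cast hn)]
  exact h

/-- The deficits `M - xᵢ` are nonnegative, so each of them is at most their sum `≤ nη`. -/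
lemma le_of_le_average {n : ℕ} (hn : 0 < n) {x : Fin n → ℝ} {M η : ℝ} (hx : ∀ i, x i ≤ M)
    (h : M - η ≤ (1 / n) * ∑ i, x i) (j : Fin n) : M - n * η ≤ x j := by
  have hn' : (0 : ℝ) < n := by exact_mod_cast hn
  have h1 : M - x j ≤ ∑ i, (M - x i) :=
    Finset.single_le_sum (f := fun i => M - x i) (fun i _ => sub_nonneg.2 (hx i))
      (Finset.mem_univ j)
  rw [Finset.sum_sub_distrib, Finset.sum_const, Finset.card_univ, Fintype.card_fin,
    nsmul_eq_mul] at h1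
  rw [one_div, ← div_eq_inv_mul, le_div_iff₀ hn'] at h
  linarith

lemma Strategy.acceptProb_le_one (q : Round r) : S.acceptProb q ≤ 1 := by
  rw [S.acceptProb_eq]
  linarith [S.ρ.re_tr_le (S.isReflection_roundOp q).norm_le]

lemma Strategy.special_acceptProb_le :
    (1 / 4) * ∑ j, S.acceptProb ((G.spsOperator t j).specialRound t) ≤
      1 / 2 + Real.sqrt 2 / 4 := by
  rw [S.special_acceptProb]
  have : 0 ≤ Real.sqrt 2 / 16 * S.chshDefect G t := by
    unfold Strategy.chshDefect; positivity
  linarith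

variable {S G} {ε : ℝ}

lemma Strategy.norm_vec_roundOp_sub_one_sq_le (hr : 0 < r) (hl : 0 < l)
    (hv : omegaS - ε ≤ G.value S) (j : Fin l) :
    ‖S.ρ.vec (S.roundOp (G.gen j).round - 1)‖ ^ 2 ≤ 8 * l * ε := by
  have h2 : G.testTwo S ≤ 1 / 2 + Real.sqrt 2 / 4 :=
    average_le hr fun t => S.special_acceptProb_le G t
  have h1 : 1 - 2 * ε ≤ G.testOne S := by
    rw [XZStabilizer.value, omegaS] at hv
    linarith
  have h3 := le_of_le_average hl (fun j => S.acceptProb_le_one (G.gen j).round) h1 j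
  rw [S.acceptProb_eq] at h3
  rw [S.ρ.norm_vec_sub_one_sq (S.isReflection_roundOp _)]
  linarith

lemma Strategy.chshDefect_le (hr : 0 < r) (hl : 0 < l) (hv : omegaS - ε ≤ G.value S) :
    S.chshDefect G t ≤ 32 * r * ε := by
  have h1 : G.testOne S ≤ 1 := average_le hl fun j => S.acceptProb_le_one _
  have h2 : (1 / 2 + Real.sqrt 2 / 4) - 2 * ε ≤ G.testTwo S := by
    rw [XZStabilizer.value, omegaS] at hv
    linarith
  have h3 := le_of_le_average hr (fun t => S.special_acceptProb_le G t) h2 t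
  rw [S.special_acceptProb] at h3
  -- What is known is `√2/16 · defect ≤ 2rε`; the factor `√2` is dropped.
  have h4 : (1 : ℝ) ≤ Real.sqrt 2 := Real.one_le_sqrt.2 one_le_two
  have h5 : 0 ≤ S.chshDefect G t := by unfold Strategy.chshDefect; positivity
  nlinarith

end Acceptance

/-! ## Rigidity -/

section Rigidity

open ContinuousLinearMap

variable {r l : ℕ} {H : Fin r → Type u} [∀ i, NormedAddCommGroup (H i)]
    [∀ i, InnerProductSpace ℂ (H i)]
variable {K : Fin r → Type u} [∀ i, NormedAddCommGroup (K i)]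
    [∀ i, InnerProductSpace ℂ (K i)] [∀ i, CompleteSpace (K i)]

lemma onFactor_mul (i : Fin r) (A B : H i →L[ℂ] H i) :
    onFactor i (A * B) = onFactor i A * onFactor i B := map_mul (onFactorHom H i) A B

lemma onFactor_sub (i : Fin r) (A B : H i →L[ℂ] H i) :
    onFactor i (A - B) = onFactor i A - onFactor i B := map_sub (onFactorHom H i) A B

lemma onFactor_add (i : Fin r) (A B : H i →L[ℂ] H i) :
    onFactor i (A + B) = onFactor i A + onFactor i B := map_add (onFactorHom H i) A B

lemma onFactor_smul (i : Fin r) (c : ℂ) (A : H i →L[ℂ] H i) :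
    onFactor i (c • A) = c • onFactor i A := map_smul (onFactorHom H i) c A

lemma onFactor_oddPart (i : Fin r) (A B : H i →L[ℂ] H i) :
    onFactor i (oddPart A B) = oddPart (onFactor i A) (onFactor i B) := by
  rw [oddPart, onFactor_smul, onFactor_sub, onFactor_mul, onFactor_mul, oddPart]

variable [∀ i, CompleteSpace (H i)]

/-- The strategy `S` passes every individual check of the stabilizer game up to an error `δ`, in the
state-dependent norm. -/
structure Strategy.IsNearOptimal (S : Strategy H) (G : XZStabilizer r l) (δ : ℝ) : Prop where
  round : ∀ j, ‖S.ρ.vec (S.roundOp (G.gen j).round - 1)‖ ≤ δ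
  chshX : ∀ t, ‖S.ρ.vec (S.restOp (G.gen (G.selX t)) t -
    (invSqrtTwo : ℂ) • (onFactor t (S.R t 2) + onFactor t (S.R t 3)))‖ ≤ δ
  chshZ : ∀ t, ‖S.ρ.vec (S.restOp (G.gen (G.selZ t)) t -
    (invSqrtTwo : ℂ) • (onFactor t (S.R t 2) - onFactor t (S.R t 3)))‖ ≤ δ

lemma Strategy.isNearOptimal_of_value {S : Strategy H} {G : XZStabilizer r l} {ε : ℝ}
    (hr : 0 < r) (hl : 0 < l) (hε : 0 ≤ ε) (hv : omegaS - ε ≤ G.value S) :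
    S.IsNearOptimal G (Real.sqrt (32 * (l + r) * ε)) := by
  have hlε : 0 ≤ l * ε := by positivity
  have hrε : 0 ≤ r * ε := by positivity
  refine ⟨fun j => Real.le_sqrt_of_sq_le ?_, fun t => Real.le_sqrt_of_sq_le ?_,
    fun t => Real.le_sqrt_of_sq_le ?_⟩
  · linarith [norm_vec_roundOp_sub_one_sq_le hr hl hv j]
  all_goals
    have h := chshDefect_le t hr hl hv
    rw [Strategy.chshDefect] at h
    nlinarith [sq_nonneg ‖S.ρ.vec (S.restOp (G.gen (G.selX t)) t -
      (invSqrtTwo : ℂ) • (onFactor t (S.R t 2) + onFactor t (S.R t 3)))‖,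
      sq_nonneg ‖S.ρ.vec (S.restOp (G.gen (G.selZ t)) t -
      (invSqrtTwo : ℂ) • (onFactor t (S.R t 2) - onFactor t (S.R t 3)))‖]

/-! ### Estimates for a single player -/

section Players

variable {S : Strategy H} {G : XZStabilizer r l} {δ : ℝ}

lemma Strategy.IsNearOptimal.anticomm (hS : S.IsNearOptimal G δ) (i : Fin r) :
    ‖S.ρ.vec (onFactor i (S.R i 2) * onFactor i (S.R i 3) +
    onFactor i (S.R i 3) * onFactor i (S.R i 2))‖ ≤ 5 * δ :=
  (norm_vec_anticomm_le S.ρ (S.isReflection_restOp (G.gen (G.selX i)) i)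
    (isReflection_onFactor i (S.isReflection i 2)) (isReflection_onFactor i (S.isReflection i 3))
    (S.restOp_commute _ i _) (S.restOp_commute _ i _)).trans
    (mul_le_mul_of_nonneg_left (hS.chshX i) (by norm_num))

lemma Strategy.IsNearOptimal.playerDist_oddPart (hS : S.IsNearOptimal G δ) (i : Fin r) :
   
    playerDist S.ρ i (S.R i 2) (oddPart (S.R i 2) (S.R i 3)) ≤ 5 / 2 * δ := by
  have h := one_sub_re_tr_oddPart S.ρ (isReflection_onFactor i (S.isReflection i 2))
    (isReflection_onFactor i (S.isReflection i 3))
  rw [← onFactor_oddPart, ← onFactor_mul] at h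
  change Real.sqrt (1 - (S.ρ.tr (onFactor i (S.R i 2 * _))).re) ≤ _
  rw [h, Real.sqrt_sq (by positivity)]
  linarith [hS.anticomm i]

lemma Strategy.IsNearOptimal.norm_vec_invSqrtTwo_smul_le (hS : S.IsNearOptimal G δ) (i : Fin r) :
   
    ‖S.ρ.vec ((invSqrtTwo : ℂ) • (onFactor i (S.R i 2) -
      oddPart (onFactor i (S.R i 2)) (onFactor i (S.R i 3))))‖ ≤ 2 * δ := by
  have h := norm_vec_sub_oddPart_le S.ρ (a := onFactor i (S.R i 2))
    (isReflection_onFactor i (S.isReflection i 3))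
  rw [map_smul, norm_smul, Complex.norm_real, Real.norm_of_nonneg invSqrtTwo_pos.le]
  -- The constant comes from `3/4 · 5/2 < 2`.
  nlinarith [hS.anticomm i, invSqrtTwo_le, invSqrtTwo_pos, norm_nonneg (S.ρ.vec
    (onFactor i (S.R i 2) - oddPart (onFactor i (S.R i 2)) (onFactor i (S.R i 3))))]

lemma Strategy.IsNearOptimal.norm_vec_X_le (hS : S.IsNearOptimal G δ) (i : Fin r) :
    ‖S.ρ.vec (onFactor i (S.R i 0 -
    (invSqrtTwo : ℂ) • (oddPart (S.R i 2) (S.R i 3) + S.R i 3)))‖ ≤ 4 * δ := by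
  rw [onFactor_sub, onFactor_smul, onFactor_add, onFactor_oddPart]
  refine norm_vec_sub_le_of_correlated S.ρ (S.isReflection_restOp (G.gen (G.selX i)) i) ?_
    (hS.chshX i) ?_
  · rw [← S.roundOp_selX]
    exact hS.round _
  · rw [← smul_sub, add_sub_add_right_eq_sub]
    exact hS.norm_vec_invSqrtTwo_smul_le i

lemma Strategy.IsNearOptimal.norm_vec_Z_le (hS : S.IsNearOptimal G δ) (i : Fin r) :
    ‖S.ρ.vec (onFactor i (S.R i 1 -
    (invSqrtTwo : ℂ) • (oddPart (S.R i 2) (S.R i 3) - S.R i 3)))‖ ≤ 4 * δ := by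
  rw [onFactor_sub, onFactor_smul, onFactor_sub, onFactor_oddPart]
  refine norm_vec_sub_le_of_correlated S.ρ (S.isReflection_restOp (G.gen (G.selZ i)) i) ?_
    (hS.chshZ i) ?_
  · rw [← S.roundOp_selZ]
    exact hS.round _
  · rw [← smul_sub, sub_sub_sub_cancel_right]
    exact hS.norm_vec_invSqrtTwo_smul_le i

end Players

lemma playerDist_le_sqrt (ρ : DensityOperator (HTensor H)) (i : Fin r) {c X : H i →L[ℂ] H i}
    (hc : IsReflection c) {η : ℝ} (h : ‖ρ.vec (onFactor i (c - X))‖ ≤ η) :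
    playerDist ρ i c X ≤ Real.sqrt η := by
  refine Real.sqrt_le_sqrt ?_
  have h1 := one_sub_re_tr_mul_le ρ (isReflection_onFactor i hc) (X := onFactor i X)
  rw [← onFactor_mul, ← onFactor_sub] at h1
  exact h1.trans h

lemma adjoint_tensorIsometry_comp (V : ∀ i, H i →ₗᵢ[ℂ] QubitTensor (K i))
    (M : Fin r → Matrix (Fin 2) (Fin 2) ℂ) :
    adjoint (tensorIsometry V) ∘L qubitsOp K (tensorMatrix M) ∘L tensorIsometry V =
      tensorMap fun i => pullback (V i) (M i) := by
  rw [qubitsOp_tensorMatrix, tensorIsometry, adjoint_tensorMap, tensorMap_comp, tensorMap_comp]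
  rfl

lemma norm_tensorIsometry_apply (V : ∀ i, H i →ₗᵢ[ℂ] QubitTensor (K i)) (x : HTensor H) :
    ‖tensorIsometry V x‖ = ‖x‖ := by
  refine norm_apply_of_adjoint_comp_self ?_ x
  rw [tensorIsometry, adjoint_tensorMap, tensorMap_comp, ← tensorMap_id]
  exact congrArg _ (funext fun i => adjoint_comp_isometry (V i))

lemma isReflection_qubitsOp (g : XZPauli r) : IsReflection (qubitsOp K g.mat) := by
  refine ⟨?_, ?_⟩
  · change adjoint (qubitsOp K g.mat) = _
    rw [adjoint_qubitsOp, g.conjTranspose_mat]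
  · change qubitsOp K g.mat * qubitsOp K g.mat = 1
    rw [← qubitsOpHom_apply, ← map_mul, g.mat_mul_self, map_one]

lemma opNorm_qubitsOp_proj_le (g : XZPauli r) : ‖qubitsOp K g.proj‖ ≤ 1 := by
  have h : qubitsOp K g.proj = (1 / 2 : ℂ) • (1 + qubitsOp K g.mat) := by
    rw [← qubitsOpHom_apply, XZPauli.proj, map_smul, map_add, map_one, qubitsOpHom_apply]
  have h1 : ‖(1 : HTensor (fun i => QubitTensor (K i)) →L[ℂ] _)‖ ≤ 1 := norm_id_le
  have h2 := (isReflection_qubitsOp (K := K) g).norm_le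
  have h3 := norm_add_le (1 : HTensor (fun i => QubitTensor (K i)) →L[ℂ] _) (qubitsOp K g.mat)
  have h4 : ‖(1 / 2 : ℂ)‖ = 1 / 2 := by simp
  rw [h, norm_smul, h4]
  linarith

lemma opNorm_one_sub_codeProj_le (S : Stabilizer r) :
    ‖1 - qubitsOp K S.codeProj‖ ≤ 1 := by
  refine IsStarProjection.norm_le _ (IsStarProjection.one_sub ⟨?_, ?_⟩)
  · change qubitsOp K S.codeProj * qubitsOp K S.codeProj = _
    rw [← qubitsOpHom_apply, ← map_mul, S.codeProj_mul_self]
  · change adjoint (qubitsOp K S.codeProj) = _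
    rw [adjoint_qubitsOp, S.conjTranspose_codeProj]

/-- For a tensor product operator, conjugation by `V` acts factor by factor, so the cross term in
the expanded square is the trace of the pulled back generator. The other two terms are at most `1`.
Taking the square root here costs the exponent `1/4` in the code overlap. -/
lemma norm_vec_gen_sub_sq_le (ρ : DensityOperator (HTensor H))
    (V : ∀ i, H i →ₗᵢ[ℂ] QubitTensor (K i)) (g : XZPauli r) :
    ‖ρ.vec (qubitsOp K g.mat ∘L tensorIsometry V - tensorIsometry V)‖ ^ 2 ≤
      2 * ‖ρ.vec (paritySign g.sign •
        tensorMap (fun i => pullback (V i) (g.word i).toPauli.mat) - 1)‖ := by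
  have h1 : ⟪ρ.vec (tensorIsometry V), ρ.vec (qubitsOp K g.mat ∘L tensorIsometry V)⟫_ℂ =
      ρ.tr (paritySign g.sign •
        tensorMap fun i => pullback (V i) (g.word i).toPauli.mat) := by
    rw [ρ.inner_vec, ← adjoint_tensorIsometry_comp, g.mat_eq, ← qubitsOpHom_apply, map_smul,
      smul_comp, comp_smul, qubitsOpHom_apply]
  have h2 := ρ.norm_vec_isometry _ (norm_tensorIsometry_apply V)
  have h3 : ‖ρ.vec (qubitsOp K g.mat ∘L tensorIsometry V)‖ ≤ 1 := by
    refine (ρ.norm_vec_comp_le _ _).trans ?_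
    rw [h2, mul_one]
    exact (isReflection_qubitsOp g).norm_le
  have h4 := ρ.one_sub_re_tr_le (paritySign g.sign •
    tensorMap fun i => pullback (V i) (g.word i).toPauli.mat)
  rw [map_sub, norm_sub_rev, norm_sub_sq (𝕜 := ℂ), h1, h2]
  rw [RCLike.re_eq_complex_re]
  nlinarith [norm_nonneg (ρ.vec (qubitsOp K g.mat ∘L tensorIsometry V))]

/-- A state that is almost stabilized by the generators has a large overlap with the code space. -/
lemma one_sub_le_codeOverlap (ρ : DensityOperator (HTensor H))
    (V : ∀ i, H i →ₗᵢ[ℂ] QubitTensor (K i)) (G : XZStabilizer r l) {η : ℝ}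
    (h : ∀ j, ‖ρ.vec (qubitsOp K (G.gen j).mat ∘L tensorIsometry V - tensorIsometry V)‖ ≤ 2 * η) :
    1 - l * η ≤ codeOverlap G.toStabilizer ρ V := by
  set W := tensorIsometry V with hW
  set Q := (List.ofFn fun j => (G.gen j).proj).prod with hQ
  have hW1 : ‖ρ.vec W‖ = 1 := ρ.norm_vec_isometry _ (norm_tensorIsometry_apply V)
  have h1 : ‖ρ.vec (qubitsOp K Q ∘L W - W)‖ ≤ l * η := by
    have e : qubitsOp K Q = (List.ofFn fun j => qubitsOp K (G.gen j).proj).prod := by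
      rw [← qubitsOpHom_apply, hQ, map_list_prod, List.map_ofFn]
      rfl
    have h2 := norm_vec_list_prod_sub_le ρ W (η := η)
      (List.ofFn fun j => qubitsOp K (G.gen j).proj) (by
        intro p hp
        obtain ⟨j, rfl⟩ := List.mem_ofFn.1 hp
        refine ⟨opNorm_qubitsOp_proj_le _, ?_⟩
        -- The projection `(1 + g)/2` moves the state half as far as `g` does.
        have e2 : qubitsOp K (G.gen j).proj ∘L W - W =
            (1 / 2 : ℂ) • (qubitsOp K (G.gen j).mat ∘L W - W) := by
          rw [← qubitsOpHom_apply, XZPauli.proj, map_smul, map_add, map_one, smul_comp, add_comp,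
            qubitsOpHom_apply]
          change (1 / 2 : ℂ) • (ContinuousLinearMap.id ℂ _ ∘L W + _) - W = _
          rw [id_comp]
          module
        have h4 : ‖(1 / 2 : ℂ)‖ = 1 / 2 := by simp
        rw [e2, map_smul, norm_smul, h4]
        linarith [h j])
    rwa [List.length_ofFn, ← e] at h2
  -- Since `ΠQ = Q`, the contraction `1 - Π` annihilates `QW` and sees only the small error `QW -
  -- W`.
  have h2 : W - qubitsOp K G.codeProj ∘L W =
      (-(1 - qubitsOp K G.codeProj)) ∘L (qubitsOp K Q ∘L W - W) := by
    have e : qubitsOp K G.codeProj ∘L qubitsOp K Q = qubitsOp K Q := by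
      change qubitsOpHom K _ * qubitsOpHom K _ = qubitsOpHom K _
      rw [← map_mul, G.codeProj_mul_eq fun g hg => G.mul_prod_proj hg]
    rw [neg_sub, sub_comp, comp_sub, ← comp_assoc, e]
    change _ = _ - ContinuousLinearMap.id ℂ _ ∘L _
    rw [id_comp]
    abel
  have h3 : ‖ρ.vec (W - qubitsOp K G.codeProj ∘L W)‖ ≤ l * η := by
    rw [h2]
    refine (ρ.norm_vec_comp_le _ _).trans ((mul_le_of_le_one_left (norm_nonneg _) ?_).trans h1)
    rw [norm_neg]
    exact opNorm_one_sub_codeProj_le _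
  have h4 := (Complex.re_le_norm _).trans
    (norm_inner_le_norm (𝕜 := ℂ) (ρ.vec W) (ρ.vec (W - qubitsOp K G.codeProj ∘L W)))
  rw [hW1, one_mul, map_sub, inner_sub_right, Complex.sub_re, ← RCLike.re_eq_complex_re,
    inner_self_eq_norm_sq, hW1, ← map_sub] at h4
  rw [codeOverlap, ρ.trace_conj, ← RCLike.re_eq_complex_re]
  linarith

/-- The generators are distinct pairs of a sign and a word in three letters. This removes `l` from
the final constant. -/
lemma XZStabilizer.card_le (G : XZStabilizer r l) : l ≤ 2 * 3 ^ r := by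
  let φ : XZ → Fin 3 := fun w => match w with | .I => 0 | .X => 1 | .Z => 2
  have hφ : Function.Injective φ := by
    intro a b h
    cases a <;> cases b <;> simp_all [φ]
  have h : Function.Injective fun j : Fin l =>
      (((G.gen j).sign, fun i => φ ((G.gen j).word i)) : ZMod 2 × (Fin r → Fin 3)) := by
    intro j k hjk
    refine G.gen_injective ?_
    rw [Prod.mk.injEq] at hjk
    have hw : (G.gen j).word = (G.gen k).word :=
      funext fun i => hφ (congrFun hjk.2 i)
    cases hj : G.gen j
    cases hk : G.gen k
    simp_all
  simpa using Fintype.card_le_of_injective _ h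

lemma Strategy.IsNearOptimal.rigidity {S : Strategy H} {G : XZStabilizer r l} {δ : ℝ}
    (hS : S.IsNearOptimal G δ) (hδ : 0 ≤ δ) : ∃ V : ∀ i, H i →ₗᵢ[ℂ] QubitTensor (H i),
      (∀ i, S.R i 3 = pullback (V i) matZ' ∧
        playerDist S.ρ i (S.R i 2) (pullback (V i) matX') ≤ 5 / 2 * δ ∧
        playerDist S.ρ i (S.R i 1) (pullback (V i) Pauli.Z.mat) ≤ Real.sqrt (4 * δ) ∧
        playerDist S.ρ i (S.R i 0) (pullback (V i) Pauli.X.mat) ≤ Real.sqrt (4 * δ)) ∧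
      1 - l * Real.sqrt ((4 * r + 1) * δ) ≤ codeOverlap G.toStabilizer S.ρ V := by
  choose V hZ' hX' using fun i => exists_extraction (S.isReflection i 2) (S.isReflection i 3)
  have hX : ∀ i, pullback (V i) Pauli.X.mat =
      (invSqrtTwo : ℂ) • (oddPart (S.R i 2) (S.R i 3) + S.R i 3) := fun i => by
    change pullbackLin (V i) _ = _
    rw [pauliX_eq, map_smul, map_add]
    change _ • (pullback (V i) matX' + pullback (V i) matZ') = _
    rw [hX', hZ']
    rfl
  have hZ : ∀ i, pullback (V i) Pauli.Z.mat =
      (invSqrtTwo : ℂ) • (oddPart (S.R i 2) (S.R i 3) - S.R i 3) := fun i => by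
    change pullbackLin (V i) _ = _
    rw [pauliZ_eq, map_smul, map_sub]
    change _ • (pullback (V i) matX' - pullback (V i) matZ') = _
    rw [hX', hZ']
    rfl
  have hXn : ∀ i, ‖S.ρ.vec (onFactor i (S.R i 0 - pullback (V i) Pauli.X.mat))‖ ≤ 4 * δ :=
    fun i => by rw [hX]; exact hS.norm_vec_X_le i
  have hZn : ∀ i, ‖S.ρ.vec (onFactor i (S.R i 1 - pullback (V i) Pauli.Z.mat))‖ ≤ 4 * δ :=
    fun i => by rw [hZ]; exact hS.norm_vec_Z_le i
  have hw : ∀ i (w : XZ), ‖S.ρ.vec (onFactor i (pullback (V i) w.toPauli.mat -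
      S.observable i w.question))‖ ≤ 4 * δ := fun i w => by
    rw [onFactor_sub, map_sub, norm_sub_rev, ← map_sub, ← onFactor_sub]
    cases w with
    | I =>
      have h : S.observable i XZ.I.question - pullback (V i) XZ.I.toPauli.mat = 0 := by
        change ContinuousLinearMap.id ℂ (H i) - pullback (V i) 1 = 0
        rw [pullback_one, sub_self]
      rw [h, ← onFactorHom_apply, map_zero, map_zero, norm_zero]
      positivity
    | X => exact hXn i
    | Z => exact hZn i
  refine ⟨V, fun i => ⟨(hZ' i).symm, ?_, playerDist_le_sqrt _ i (S.isReflection i 1) (hZn i),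
    playerDist_le_sqrt _ i (S.isReflection i 0) (hXn i)⟩,
    one_sub_le_codeOverlap _ _ _ fun j => ?_⟩
  · rw [hX']
    exact hS.playerDist_oddPart i
  · have h2 := norm_vec_tensorMap_sub_le S.ρ
      (A := fun i => pullback (V i) ((G.gen j).word i).toPauli.mat)
      (B := fun i => S.observable i ((G.gen j).round.question i))
      (fun i => opNorm_pullback_le _ (by rw [Pauli.conjTranspose_mat, Pauli.mat_mul_self]))
      (fun i => (S.isReflection_observable i _).norm_le)
    have h3 := h2.trans (Finset.sum_le_card_nsmul _ _ _ fun i _ => hw i _)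
    rw [Finset.card_univ, Fintype.card_fin, nsmul_eq_mul] at h3
    -- Exchanging pulled back Paulis for observables costs `4δ` per player; the generator round
    -- itself costs a further `δ`.
    have h4 : ‖S.ρ.vec (paritySign (G.gen j).sign •
        tensorMap (fun i => pullback (V i) ((G.gen j).word i).toPauli.mat) - 1)‖ ≤
        (4 * r + 1) * δ := by
      have e : paritySign (G.gen j).sign •
          tensorMap (fun i => pullback (V i) ((G.gen j).word i).toPauli.mat) - 1 =
        paritySign (G.gen j).sign •
          (tensorMap (fun i => pullback (V i) ((G.gen j).word i).toPauli.mat) -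
            tensorMap fun i => S.observable i ((G.gen j).round.question i)) +
        (S.roundOp (G.gen j).round - 1) := by
        have hR : S.roundOp (G.gen j).round = paritySign (G.gen j).sign •
            tensorMap fun i => S.observable i ((G.gen j).round.question i) := rfl
        rw [hR, smul_sub, sub_add_sub_cancel]
      rw [e, map_add, map_smul]
      refine (norm_add_le _ _).trans ?_
      rw [norm_smul, norm_paritySign, one_mul]
      linarith [hS.round j]
    have h5 := (norm_vec_gen_sub_sq_le S.ρ V (G.gen j)).trans
      (mul_le_mul_of_nonneg_left h4 two_pos.le)
    refine le_of_sq_le_sq (h5.trans ?_) (by positivity)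
    rw [mul_pow, Real.sq_sqrt (by positivity)]
    have : 0 ≤ (4 * r + 1) * δ := by positivity
    linarith

end Rigidity

end StabGame

end

/-! ### The theorem, with explicit constants -/

theorem mainTheorem6 (r : ℕ) (hr : 0 < r) :
    ∃ C : ℝ, 0 < C ∧ ∀ (l : ℕ) (G : StabGame.XZStabilizer r l)
      (H : Fin r → Type*) [∀ i, NormedAddCommGroup (H i)] [∀ i, InnerProductSpace ℂ (H i)]
      [∀ i, CompleteSpace (H i)] (S : StabGame.Strategy H) (ε : ℝ), 0 ≤ ε →
      StabGame.omegaS - ε ≤ G.value S →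
      ∃ (K : Fin r → Type _) (_ : ∀ i, NormedAddCommGroup (K i))
        (_ : ∀ i, InnerProductSpace ℂ (K i)) (_ : ∀ i, CompleteSpace (K i))
        (V : ∀ i, H i →ₗᵢ[ℂ] StabGame.QubitTensor (K i)),
        (∀ i, S.R i 3 = StabGame.pullback (V i) StabGame.matZ' ∧
          StabGame.playerDist S.ρ i (S.R i 2) (StabGame.pullback (V i) StabGame.matX')
            ≤ C * ε ^ (1 / 2 : ℝ) ∧
          StabGame.playerDist S.ρ i (S.R i 1) (StabGame.pullback (V i) StabGame.Pauli.Z.mat)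
            ≤ C * ε ^ (1 / 4 : ℝ) ∧
          StabGame.playerDist S.ρ i (S.R i 0) (StabGame.pullback (V i) StabGame.Pauli.X.mat)
            ≤ C * ε ^ (1 / 4 : ℝ)) ∧
        1 - C * ε ^ (1 / 4 : ℝ) ≤ StabGame.codeOverlap G.toStabilizer S.ρ V := by
  -- By `l ≤ 2 · 3 ^ r`, the per-check error `δ` is at most `c √ε`.
  set c := Real.sqrt (32 * (2 * 3 ^ r + r)) with hc
  have hc0 : 0 < c := by positivity
  set d := 2 * 3 ^ r * Real.sqrt ((4 * r + 1) * c) with hd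
  have hd0 : 0 ≤ d := by positivity
  -- The three summands serve the bounds for `R₂` (where `5/2 ≤ 3`), for `R₀` and `R₁`, and for the
  -- code overlap.
  refine ⟨3 * c + Real.sqrt (4 * c) + d, by positivity, ?_⟩
  intro l G H _ _ _ S ε hε hv
  -- The generator chosen for the first qubit witnesses that there is one.
  have hl : 0 < l := Fin.pos (G.selX ⟨0, hr⟩)
  have hS := StabGame.Strategy.isNearOptimal_of_value hr hl hε hv
  have hlr : (l : ℝ) ≤ 2 * 3 ^ r := by exact_mod_cast G.card_le
  have hδ : Real.sqrt (32 * (l + r) * ε) ≤ c * Real.sqrt ε := by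
    rw [hc, ← Real.sqrt_mul (by positivity)]
    gcongr
  have he2 : ε ^ (1 / 2 : ℝ) = Real.sqrt ε := (Real.sqrt_eq_rpow ε).symm
  have he4 : ε ^ (1 / 4 : ℝ) = Real.sqrt (Real.sqrt ε) := by
    rw [Real.sqrt_eq_rpow, Real.sqrt_eq_rpow, ← Real.rpow_mul hε]
    norm_num
  have hs4 : Real.sqrt (4 * Real.sqrt (32 * (l + r) * ε)) ≤
      (3 * c + Real.sqrt (4 * c) + d) * Real.sqrt (Real.sqrt ε) := by
    calc _ ≤ Real.sqrt (4 * c * Real.sqrt ε) := Real.sqrt_le_sqrt (by linarith)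
      _ = Real.sqrt (4 * c) * Real.sqrt (Real.sqrt ε) := Real.sqrt_mul (by positivity) _
      _ ≤ _ := by gcongr; linarith
  obtain ⟨V, hV, hcode⟩ := hS.rigidity (Real.sqrt_nonneg _)
  refine ⟨H, inferInstance, inferInstance, inferInstance, V, fun i => ⟨(hV i).1, ?_, ?_, ?_⟩, ?_⟩
  · rw [he2]
    have : 0 ≤ (Real.sqrt (4 * c) + d) * Real.sqrt ε := by positivity
    have : 0 ≤ c * Real.sqrt ε := by positivity
    linarith [(hV i).2.1]
  · rw [he4]
    exact (hV i).2.2.1.trans hs4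
  · rw [he4]
    exact (hV i).2.2.2.trans hs4
  · rw [he4]
    have h1 : l * Real.sqrt ((4 * r + 1) * Real.sqrt (32 * (l + r) * ε)) ≤
        d * Real.sqrt (Real.sqrt ε) := by
      calc _ ≤ 2 * 3 ^ r * Real.sqrt ((4 * r + 1) * (c * Real.sqrt ε)) := by gcongr
        _ = d * Real.sqrt (Real.sqrt ε) := by
          rw [hd, ← mul_assoc (4 * (r : ℝ) + 1), Real.sqrt_mul (by positivity)]
          ring
    have : 0 ≤ (3 * c + Real.sqrt (4 * c)) * Real.sqrt (Real.sqrt ε) := by positivity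
    linarith
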